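/- Let $G$ be an infinite group generated by a finite set $S$ and having Kazhdan's property (T). Let $N_0\supseteq N_1\supseteq N_2\supseteq\cdots$ be normal subgroups of finite index in $G$ with $\bigcap_i N_i=\{e\}$ (so $G$ is residually finite). Let $X=\bigsqcup_i G/N_i$ be the box space: the disjoint union with any metric $d$ whose restriction to each $G/N_i$ is the quotient of the left-invariant word metric $d(a,b)=|a^{-1}b|_S$ on $G$, and with $d(G/N_i,G/N_j)\ge i+j$ for $i\ne j$. Let $1<p<\infty$ and $\ell^p=\ell^p(\mathbb N)$ (complex sequences). Fix a countable dense subset $Z\subseteq X$, and for a bounded operator $T$ on $\ell^p(Z,\ell^p)$ let $T_{x,y}\in B(\ell^p)$ $(x,y\in Z)$ be its matrix entries. Let $\mathbb C^p[X]\subseteq B(\ell^p(Z,\ell^p))$ be the algebra of those $T$ such that * $T$ has finite propagation: for some $R>0$, $T_{x,y}=0$ whenever $d(x,y)>R$; * $T$ is locally compact: every $T_{x,y}$ is a compact operator, and for every bounded $B\subseteq X$ only finitely many pairs $(x,y)\in (B\times B)\cap (Z\times Z)$ have $T_{x,y}\ne0$. Let $B^p(X)$ be the norm closure of $\mathbb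 C^p[X]$. An operator $T\in B^p(X)$ is a ghost if for all $R,\varepsilon>0$ there is a bounded $B\subseteq X$ such that $\|T\xi\|<\varepsilon$ for every $\xi$ of norm one supported in the open ball of radius $R$ about some $x\in X\setminus B$. Then there exists a non-compact ghost idempotent $Q=Q^2$ in $B^p(X)$. More precisely, let $q_i=\frac{1}{[G:N_i]}M_i$, where $M_i$ is the matrix indexed by $G/N_i$ with all entries equal to $1$, and let $q=\bigoplus_i q_i$. For $f=\sum_g f(g)g$ in the group ring of $G$, let $\rho_i(f)=\sum_g f(g)\rho_i(g)$, where $(\rho_i(g)\xi)(x)=\xi(xg)$ is the right regular representation of $G$ on $\ell^p(G/N_i)$. Then there is a finitely supported probability measure $\mu$ on $G$ such that, writing $\mu^n$ for its $n$-fold convolution power: 1. $\|\rho_i(\mu^n)-q_i\|_{B(\ell^p(G/N_i))}\to0$ as $n\to\infty$, uniformly in $i$; 2. for every nonzero finite-rank idempotent $P\in B(\ell^p)$, the matrix $Q_{x,y}=q(x,y)P$ $(x,y\in Z)$ defines a bounded operator $Q$ on $\ell^p(Z,\ell^p)$, which is a non-compact ghost idempotent in $B^p(X)$. Moreover, for every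 $n$ the matrix $\bigl(\bigoplus_i\rho_i(\mu^n)\bigr)(x,y)P$ defines an operator $T_n\in\mathbb C^p[X]$, and $\|T_n-Q\|\to0$ as $n\to\infty$. -/

import Mathlib

open scoped ENNReal Topology
open Filter

noncomputable section

/-! ## Property (T) -/

/-- Kazhdan's property (T) for a discrete group `G`: there is a Kazhdan pair `(K, ε)`, i.e. every
unitary representation of `G` with a `(K, ε)`-invariant vector has a nonzero invariant vector. -/
def HasPropertyT.{u} (G : Type u) [Group G] : Prop :=
  ∃ (K : Finset G) (ε : ℝ), 0 < ε ∧
    ∀ (H : Type u) [NormedAddCommGroup H] [InnerProductSpace ℂ H] [CompleteSpace H]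
      (π : G →* (H ≃ₗᵢ[ℂ] H)),
      (∃ v : H, v ≠ 0 ∧ ∀ g ∈ K, ‖π g v - v‖ < ε * ‖v‖) →
        ∃ v : H, v ≠ 0 ∧ ∀ g : G, π g v = v

/-! ## Operators on `ℓ^p(Z, ℓ^p)` -/

/-- The space `ℓ^p = ℓ^p(ℕ)` of complex sequences. -/
abbrev EllP (p : ℝ≥0∞) : Type := lp (fun _ : ℕ => ℂ) p

/-- The space `ℓ^p(Z, ℓ^p)`. -/
abbrev EllPOn.{u} (p : ℝ≥0∞) [Fact (1 ≤ p)] (Z : Type u) : Type u := lp (fun _ : Z => EllP p) p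

section Operators

variable {Z : Type*} {p : ℝ≥0∞} [Fact (1 ≤ p)]

/-- Evaluation at a point, `ξ ↦ ξ x`, as a bounded operator `ℓ^p(Z, ℓ^p) → ℓ^p`. -/
def evalAt (p : ℝ≥0∞) [Fact (1 ≤ p)] (x : Z) : EllPOn p Z →L[ℂ] EllP p :=
  LinearMap.mkContinuous
    { toFun := fun ξ => ξ x
      map_add' := fun _ _ => rfl
      map_smul' := fun _ _ => rfl } 1
    (fun ξ => by
      rw [one_mul]
      exact lp.norm_apply_le_norm (zero_lt_one.trans_le (Fact.out : 1 ≤ p)).ne' ξ x)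

open scoped Classical in
/-- The inclusion `v ↦ δ_y ⊗ v` of `ℓ^p` in `ℓ^p(Z, ℓ^p)` at a point `y`. -/
def inclAt (p : ℝ≥0∞) [Fact (1 ≤ p)] (y : Z) : EllP p →L[ℂ] EllPOn p Z :=
  lp.singleContinuousLinearMap ℂ (fun _ : Z => EllP p) p y

/-- The matrix entry `T_{x,y} : ℓ^p → ℓ^p` of a bounded operator `T` on `ℓ^p(Z, ℓ^p)`. -/
def entry (T : EllPOn p Z →L[ℂ] EllPOn p Z) (x y : Z) : EllP p →L[ℂ] EllP p :=
  (evalAt p x).comp (T.comp (inclAt p y))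

theorem entry_apply (T : EllPOn p Z →L[ℂ] EllPOn p Z) (x y : Z) (v : EllP p) :
    entry T x y v = T (inclAt p y v) x := rfl

theorem entry_zero (x y : Z) : entry (0 : EllPOn p Z →L[ℂ] EllPOn p Z) x y = 0 := rfl

theorem entry_add (S T : EllPOn p Z →L[ℂ] EllPOn p Z) (x y : Z) :
    entry (S + T) x y = entry S x y + entry T x y := rfl

theorem entry_smul (c : ℂ) (T : EllPOn p Z →L[ℂ] EllPOn p Z) (x y : Z) :
    entry (c • T) x y = c • entry T x y := rfl

/-- If the `z`-th column of `T` vanishes off the finite set `F`, then the `z`-th column of `S T`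
is given by matrix multiplication. -/
theorem entry_mul (S T : EllPOn p Z →L[ℂ] EllPOn p Z) (z : Z) (F : Finset Z)
    (hF : ∀ y, y ∉ F → entry T y z = 0) (x : Z) :
    entry (S * T) x z = ∑ y ∈ F, (entry S x y).comp (entry T y z) := by
  classical
  ext1 v
  have h : T (inclAt p z v) = ∑ y ∈ F, inclAt p y (entry T y z v) := by
    ext1
    funext y
    have h1 : (∑ w ∈ F, inclAt p w (entry T w z v)) y
        = ∑ w ∈ F, (inclAt p w (entry T w z v)) y := by
      rw [lp.coeFn_sum, Finset.sum_apply]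
    have h2 : ∀ w, (inclAt p w (entry T w z v)) y = if y = w then entry T w z v else 0 := by
      intro w
      change lp.single (E := fun _ : Z => EllP p) p w (entry T w z v) y = _
      rw [lp.single_apply, Pi.single_apply]
    rw [h1, Finset.sum_congr rfl (fun w _ => h2 w), Finset.sum_ite_eq]
    split_ifs with hy
    · rfl
    · have := hF y hy
      change entry T y z v = 0
      rw [this]; rfl
  have h3 : entry (S * T) x z v = evalAt p x (S (T (inclAt p z v))) := rfl
  rw [h3, h, map_sum, map_sum, sum_apply]
  rfl

end Operators

/-! ## Roe algebras -/

section Roe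

variable {X : Type*} [MetricSpace X] {Z : Set X} {p : ℝ≥0∞} [Fact (1 ≤ p)]

/-- `T` has finite propagation: `T_{x,y} = 0` whenever `d(x,y) > S`, for some `S > 0`. -/
def FinitePropagation (T : EllPOn p Z →L[ℂ] EllPOn p Z) : Prop :=
  ∃ S : ℝ, 0 < S ∧ ∀ x y : Z, S < dist (x : X) (y : X) → entry T x y = 0

/-- `T` is locally compact: all its matrix entries are compact operators, and only finitely many
of them are nonzero over each bounded subset of `X`. -/
def LocallyCompactOperator (T : EllPOn p Z →L[ℂ] EllPOn p Z) : Prop :=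
  (∀ x y : Z, IsCompactOperator (entry T x y)) ∧
    ∀ B : Set X, Bornology.IsBounded B →
      {q : Z × Z | (q.1 : X) ∈ B ∧ (q.2 : X) ∈ B ∧ entry T q.1 q.2 ≠ 0}.Finite

theorem isCompactOperator_finset_sum {ι E F : Type*} [NormedAddCommGroup E] [NormedSpace ℂ E]
    [NormedAddCommGroup F] [NormedSpace ℂ F] (s : Finset ι) (f : ι → E →L[ℂ] F)
    (h : ∀ i ∈ s, IsCompactOperator (f i)) : IsCompactOperator (∑ i ∈ s, f i : E →L[ℂ] F) := by
  classical
  induction s using Finset.induction_on with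
  | empty => simpa using isCompactOperator_zero
  | insert a s ha ih =>
    rw [Finset.sum_insert ha]
    exact (h a (Finset.mem_insert_self _ _)).add
      (ih fun i hi => h i (Finset.mem_insert_of_mem hi))

theorem column_finite {T : EllPOn p Z →L[ℂ] EllPOn p Z} (hT : FinitePropagation T)
    (hT' : LocallyCompactOperator T) (z : Z) : {y : Z | entry T y z ≠ 0}.Finite := by
  obtain ⟨S, hS, h⟩ := hT
  refine ((hT'.2 _ (Metric.isBounded_closedBall (x := (z : X)) (r := S))).image Prod.fst).subset ?_
  intro y hy
  refine ⟨(y, z), ⟨?_, Metric.mem_closedBall_self hS.le, hy⟩, rfl⟩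
  by_contra hn
  exact hy (h y z (by simpa [Metric.mem_closedBall] using hn))

theorem exists_entry_ne_zero {S T : EllPOn p Z →L[ℂ] EllPOn p Z} (hT : FinitePropagation T)
    (hT' : LocallyCompactOperator T) {x z : Z} (h : entry (S * T) x z ≠ 0) :
    ∃ y, entry S x y ≠ 0 ∧ entry T y z ≠ 0 := by
  have hfin := column_finite hT hT' z
  rw [entry_mul S T z hfin.toFinset (fun y hy => by simpa using hy) x] at h
  obtain ⟨y, -, hy⟩ := Finset.exists_ne_zero_of_sum_ne_zero h
  refine ⟨y, fun h0 => hy ?_, fun h0 => hy ?_⟩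
  · rw [h0]; exact ContinuousLinearMap.zero_comp _
  · rw [h0]; exact ContinuousLinearMap.comp_zero _

/-- The algebraic Roe algebra `ℂ^p[X]` of `X` (formed with the countable dense subset `Z`): the
algebra of finite propagation, locally compact operators on `ℓ^p(Z, ℓ^p)`. -/
def algebraicRoeAlgebra (p : ℝ≥0∞) [Fact (1 ≤ p)] (Z : Set X) :
    NonUnitalSubalgebra ℂ (EllPOn p Z →L[ℂ] EllPOn p Z) where
  carrier := {T | FinitePropagation T ∧ LocallyCompactOperator T}
  zero_mem' := by
    refine ⟨⟨1, one_pos, fun x y _ => rfl⟩, fun x y => ?_, fun B _ => ?_⟩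
    · simpa [entry_zero] using isCompactOperator_zero
    · simp [entry_zero]
  add_mem' := by
    rintro S T ⟨⟨a, ha, hSa⟩, hS1, hS2⟩ ⟨⟨b, hb, hTb⟩, hT1, hT2⟩
    refine ⟨⟨max a b, lt_max_of_lt_left ha, fun x y h => ?_⟩, fun x y => ?_, fun B hB => ?_⟩
    · rw [entry_add, hSa x y ((le_max_left _ _).trans_lt h),
        hTb x y ((le_max_right _ _).trans_lt h), add_zero]
    · rw [entry_add]; exact (hS1 x y).add (hT1 x y)
    · refine ((hS2 B hB).union (hT2 B hB)).subset ?_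
      rintro q ⟨h1, h2, h3⟩
      by_cases h0 : entry S q.1 q.2 = 0
      · refine Or.inr ⟨h1, h2, fun h0' => h3 ?_⟩
        rw [entry_add, h0, h0', add_zero]
      · exact Or.inl ⟨h1, h2, h0⟩
  smul_mem' := by
    rintro c T ⟨⟨b, hb, hTb⟩, hT1, hT2⟩
    refine ⟨⟨b, hb, fun x y h => ?_⟩, fun x y => ?_, fun B hB => ?_⟩
    · rw [entry_smul, hTb x y h, smul_zero]
    · rw [entry_smul]; exact (hT1 x y).smul c
    · refine (hT2 B hB).subset ?_
      rintro q ⟨h1, h2, h3⟩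
      refine ⟨h1, h2, fun h0 => h3 ?_⟩
      rw [entry_smul, h0, smul_zero]
  mul_mem' := by
    rintro S T ⟨⟨a, ha, hSa⟩, hS1, hS2⟩ ⟨⟨b, hb, hTb⟩, hT1, hT2⟩
    have hTf : FinitePropagation T := ⟨b, hb, hTb⟩
    have hTl : LocallyCompactOperator T := ⟨hT1, hT2⟩
    refine ⟨⟨a + b, add_pos ha hb, fun x z h => ?_⟩, fun x z => ?_, fun B hB => ?_⟩
    · by_contra hne
      obtain ⟨y, h1, h2⟩ := exists_entry_ne_zero hTf hTl hne
      have h3 : dist (x : X) y ≤ a := not_lt.1 fun h' => h1 (hSa x y h')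
      have h4 : dist (y : X) z ≤ b := not_lt.1 fun h' => h2 (hTb y z h')
      linarith [dist_triangle (x : X) y z]
    · have hfin := column_finite hTf hTl z
      rw [entry_mul S T z hfin.toFinset (fun y hy => by simpa using hy) x]
      exact isCompactOperator_finset_sum _ _ fun y _ => (hS1 x y).comp_clm (entry T y z)
    · have hB' : Bornology.IsBounded (Metric.cthickening b B) := hB.cthickening
      refine (((hS2 _ hB').image Prod.fst).prod ((hT2 _ hB').image Prod.snd)).subset ?_
      rintro ⟨x, z⟩ ⟨h1, h2, h3⟩
      obtain ⟨y, h4, h5⟩ := exists_entry_ne_zero hTf hTl h3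
      have h6 : dist (y : X) z ≤ b := not_lt.1 fun h' => h5 (hTb y z h')
      have hy : (y : X) ∈ Metric.cthickening b B :=
        Metric.mem_cthickening_of_dist_le _ _ _ _ h2 h6
      exact ⟨⟨(x, y), ⟨Metric.self_subset_cthickening B h1, hy, h4⟩, rfl⟩,
        ⟨(y, z), ⟨hy, Metric.self_subset_cthickening B h2, h5⟩, rfl⟩⟩

/-- The `ℓ^p` Roe algebra `B^p(X)`: the norm closure of `ℂ^p[X]`. -/
def roeAlgebra (p : ℝ≥0∞) [Fact (1 ≤ p)] (Z : Set X) :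
    NonUnitalSubalgebra ℂ (EllPOn p Z →L[ℂ] EllPOn p Z) :=
  (algebraicRoeAlgebra p Z).topologicalClosure

/-- The ghost condition: for all `R, ε > 0` there is a bounded `B ⊆ X` such that `‖T ξ‖ < ε` for
all `ξ` of norm one supported in the open ball of radius `R` about a point outside `B`. -/
def IsGhost (T : EllPOn p Z →L[ℂ] EllPOn p Z) : Prop :=
  ∀ R ε : ℝ, 0 < R → 0 < ε → ∃ B : Set X, Bornology.IsBounded B ∧
    ∀ x : X, x ∉ B → ∀ ξ : EllPOn p Z, ‖ξ‖ = 1 →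
      (∀ z : Z, ξ z ≠ 0 → (z : X) ∈ Metric.ball x R) → ‖T ξ‖ < ε

end Roe

/-! ## Box spaces -/

section Box

variable {G : Type*} [Group G]

/-- The word length of `g` with respect to `S`: the least length of a word in the letters
`S ∪ S⁻¹` with product `g` (meaningful when `S` generates `G`). -/
def wordLength (S : Finset G) (g : G) : ℕ :=
  sInf {n | ∃ l : List G, l.length = n ∧ (∀ s ∈ l, s ∈ S ∨ s⁻¹ ∈ S) ∧ l.prod = g}

/-- The quotient metric on `G ⧸ N` of the left-invariant word metric `d(a, b) = |a⁻¹ b|` on `G`: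
the least distance between representatives. -/
def quotientWordDist (S : Finset G) (N : Subgroup G) (x y : G ⧸ N) : ℕ :=
  sInf {n | ∃ a b : G, (a : G ⧸ N) = x ∧ (b : G ⧸ N) = y ∧ wordLength S (a⁻¹ * b) = n}

/-- The underlying set `⊔ i, G ⧸ N i` of the box space. -/
def BoxSpace (N : ℕ → Subgroup G) : Type _ := Σ i, G ⧸ N i

/-- The point `x ∈ G ⧸ N i` as a point of the box space. -/
def BoxSpace.pt {N : ℕ → Subgroup G} (i : ℕ) (x : G ⧸ N i) : BoxSpace N := ⟨i, x⟩

/-- The metric on the disjoint union is a box space metric: it restricts to the quotient metric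
on each `G ⧸ N i`, and `d(G ⧸ N i, G ⧸ N j) ≥ i + j` for `i ≠ j`. -/
def IsBoxMetric (S : Finset G) (N : ℕ → Subgroup G) [MetricSpace (BoxSpace N)] : Prop :=
  (∀ (i : ℕ) (x y : G ⧸ N i),
    dist (BoxSpace.pt i x : BoxSpace N) (BoxSpace.pt i y) = quotientWordDist S (N i) x y) ∧
  ∀ (i j : ℕ), i ≠ j → ∀ (x : G ⧸ N i) (y : G ⧸ N j),
    ((i : ℝ) + j) ≤ dist (BoxSpace.pt i x : BoxSpace N) (BoxSpace.pt j y)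

open scoped Classical in
/-- The matrix of `ρ_N(f) = ∑ g, f g • ρ_N(g)`, for `f` in the group ring and `ρ_N` the right
regular representation `(ρ_N(g) ξ)(x) = ξ(x g)` of `G` on functions on `G ⧸ N`. -/
def regularMatrix (N : Subgroup G) [N.Normal] (f : MonoidAlgebra ℝ G) :
    Matrix (G ⧸ N) (G ⧸ N) ℂ :=
  Matrix.of fun x y => ∑ g ∈ f.coeff.support, if x * (g : G ⧸ N) = y then (f.coeff g : ℂ) else 0

/-- The matrix `q = M / [G : N]`, where `M` is the all-ones matrix indexed by `G ⧸ N`. -/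
def averagingMatrix (N : Subgroup G) : Matrix (G ⧸ N) (G ⧸ N) ℂ :=
  Matrix.of fun _ _ => 1 / (N.index : ℂ)

/-- The block diagonal matrix `⊕ i, A i`, indexed by the box space. -/
def boxMatrix {N : ℕ → Subgroup G} (A : ∀ i, Matrix (G ⧸ N i) (G ⧸ N i) ℂ) :
    Matrix (BoxSpace N) (BoxSpace N) ℂ :=
  Matrix.blockDiagonal' A

end Box

/-- The norm of a finite square matrix as an operator on `ℓ^p(ι)`. -/
def lpOpNorm {ι : Type*} [Finite ι] (p : ℝ≥0∞) [Fact (1 ≤ p)] (A : Matrix ι ι ℂ) : ℝ :=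
  letI := Fintype.ofFinite ι
  letI := Classical.decEq ι
  ‖(Matrix.toLpLin p p A).toContinuousLinearMap‖

/-- `T` is the operator `A ⊗ P` on `ℓ^p(Z, ℓ^p)`, i.e. its matrix entries are
`T_{x,y} = A_{x,y} P`. -/
def IsTensor {X : Type*} {Z : Set X} {p : ℝ≥0∞} [Fact (1 ≤ p)] (A : Matrix X X ℂ)
    (P : EllP p →L[ℂ] EllP p) (T : EllPOn p Z →L[ℂ] EllPOn p Z) : Prop :=
  ∀ x y : Z, entry T x y = A (x : X) (y : X) • P

end

/-!
The point is a uniform spectral gap. Property (T) gives a finite set `K` of group elements such that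
averaging over `K` contracts, by one constant `c < 1`, every unitary representation without nonzero
invariant vectors: some element of `K` moves a given vector by a definite amount, and the
parallelogram law turns this into a contraction (`HasPropertyT.exists_average_contraction`). The
functions of sum zero on a finite quotient `G ⧸ N` form such a representation. Hence, for the uniform
measure `μ` on `K`, the norm of `ρ_N(μ ^ n) - q_N` on `ℓ^2(G ⧸ N)` is at most `c ^ n`, for every `N`.

The absolute row and column sums of `ρ_N(μ ^ n) - q_N` are at most `2`, which bounds its norms on
`ℓ^1` and `ℓ^∞`. Interpolating these with the bound on `ℓ^2`, by the three lines theorem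
(`exists_lpBound_of_rowColBound_of_lpBound_two`), gives decay on `ℓ^p` at a rate that depends only
on `p`; this is `HasPropertyT.exists_measure`.

By Fubini, a block diagonal matrix with blocks uniformly bounded on `ℓ^p` may be tensored with an
operator `P` on `ℓ^p` (`exists_isBlockTensor`), with control of the norm. So
`T n = (⊕ i, ρ_i(μ ^ n)) ⊗ P` converges in norm to `Q = (⊕ i, q_i) ⊗ P`. The box space is discrete,
so a dense subset is everything, and its bounded subsets are finite; hence the `T n`, whose
propagation is at most the word length of the elements of the support of `μ ^ n`, lie in the
algebraic Roe algebra when `P` has finite rank. Since the indices tend to infinity while balls of a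
given radius have boundedly many points, and since `p > 1`, averaging over far blocks makes vectors
supported in such balls small (`IsBlockTensor.isGhost`). On the other hand `Q` fixes the normalized
indicators of all blocks, with values in the range of `P`, so it is not compact
(`IsBlockTensor.not_isCompactOperator`).
-/

/-! ### Interpolation of bounds for finite matrices -/

open Matrix in
/-- `A` is bounded by `C` as an operator on the finite-dimensional space `ℓ^r(ι)`: the inequality
`‖A f‖_r ≤ C ‖f‖_r`, raised to the power `r`. -/
def LpBound {ι : Type*} [Fintype ι] (r C : ℝ) (A : Matrix ι ι ℂ) : Prop :=
  ∀ f : ι → ℂ, ∑ x, ‖(A *ᵥ f) x‖ ^ r ≤ C ^ r * ∑ y, ‖f y‖ ^ r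

/-- The absolute row sums and column sums of `A` are at most `M`; equivalently, `A` has norm at most
`M` on both `ℓ^∞` and `ℓ^1`. -/
def RowColBound {ι : Type*} [Fintype ι] (M : ℝ) (A : Matrix ι ι ℂ) : Prop :=
  (∀ x, ∑ y, ‖A x y‖ ≤ M) ∧ ∀ y, ∑ x, ‖A x y‖ ≤ M

/-- The entire function `w ↦ sgn(a) |a|^{r w}`, which takes the value `a` at `w = 1 / r`; it is zero
when `a = 0`. -/
noncomputable def interpPow (r : ℝ) (a w : ℂ) : ℂ :=
  a / (‖a‖ : ℂ) * Complex.exp (((r * Real.log ‖a‖ : ℝ) : ℂ) * w)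

theorem interpPow_inv {r : ℝ} (hr : r ≠ 0) (a : ℂ) : interpPow r a ((1 / r : ℝ) : ℂ) = a := by
  rcases eq_or_ne a 0 with rfl | ha
  · simp [interpPow]
  have h : 0 < ‖a‖ := norm_pos_iff.2 ha
  rw [interpPow, ← Complex.ofReal_mul, show r * Real.log ‖a‖ * (1 / r) = Real.log ‖a‖ by
    field_simp, ← Complex.ofReal_exp, Real.exp_log h, div_mul_cancel₀]
  exact_mod_cast h.ne'

theorem norm_interpPow_le (r : ℝ) (a w : ℂ) : ‖interpPow r a w‖ ≤ ‖a‖ ^ (r * w.re) := by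
  rcases eq_or_ne a 0 with rfl | ha
  · simpa [interpPow] using Real.rpow_nonneg le_rfl _
  have h : 0 < ‖a‖ := norm_pos_iff.2 ha
  rw [interpPow, norm_mul, norm_div, Complex.norm_real, norm_norm, div_self h.ne', one_mul,
    Complex.norm_exp, Complex.re_ofReal_mul, Real.rpow_def_of_pos h]
  exact le_of_eq (by ring_nf)

theorem differentiable_interpPow (r : ℝ) (a : ℂ) : Differentiable ℂ (interpPow r a) := by
  unfold interpPow
  fun_prop

section Interpolation

variable {ι : Type*} [Fintype ι]

/-- The analytic family of bilinear pairings to which the three lines theorem is applied, for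
conjugate exponents `r` and `s`. On the line `Re w = t`, the first argument has `ℓ^{1/t}` norm at
most `1`, and the second the dual norm at most `1`, if `f` and `g` lie in the unit balls of `ℓ^r` and
`ℓ^s`. So the lines `0`, `1/2` and `1` see the norm of `A` on `ℓ^∞`, `ℓ^2` and `ℓ^1`, and the value
at `1 / r` is the pairing of `A f` with `g`. -/
noncomputable def interpPairing (r s : ℝ) (A : Matrix ι ι ℂ) (f g : ι → ℂ) (w : ℂ) : ℂ :=
  ∑ x, ∑ y, A x y * interpPow r (f y) w * interpPow s (g x) (1 - w)

theorem differentiable_interpPairing (r s : ℝ) (A : Matrix ι ι ℂ) (f g : ι → ℂ) :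
    Differentiable ℂ (interpPairing r s A f g) := by
  unfold interpPairing
  refine Differentiable.fun_sum fun x _ => Differentiable.fun_sum fun y _ => ?_
  exact ((differentiable_const _).mul (differentiable_interpPow r _)).mul
    ((differentiable_interpPow s _).comp (by fun_prop))

theorem norm_interpPairing_le (r s : ℝ) (A : Matrix ι ι ℂ) (f g : ι → ℂ) (w : ℂ) :
    ‖interpPairing r s A f g w‖ ≤
      ∑ x, ∑ y, ‖A x y‖ * ‖f y‖ ^ (r * w.re) * ‖g x‖ ^ (s * (1 - w.re)) := by
  unfold interpPairing
  refine (norm_sum_le _ _).trans (Finset.sum_le_sum fun x _ => ?_)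
  refine (norm_sum_le _ _).trans (Finset.sum_le_sum fun y _ => ?_)
  rw [norm_mul, norm_mul]
  gcongr
  · exact norm_interpPow_le _ _ _
  · simpa using norm_interpPow_le s (g x) (1 - w)

variable {r s M ε : ℝ} {A : Matrix ι ι ℂ} {f g : ι → ℂ}

theorem norm_le_one_of_sum_rpow_le_one {r : ℝ} (hr : 0 < r) {f : ι → ℂ}
    (hf : ∑ y, ‖f y‖ ^ r ≤ 1) (y : ι) : ‖f y‖ ≤ 1 := by
  have h : ‖f y‖ ^ r ≤ 1 :=
    (Finset.single_le_sum (f := fun y => ‖f y‖ ^ r) (fun _ _ => by positivity)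
      (Finset.mem_univ y)).trans hf
  by_contra hc
  exact absurd h (not_le.2 (Real.one_lt_rpow (not_le.1 hc) hr))

theorem bddAbove_interpPairing (hr : 0 < r) (hs : 0 < s) (hf : ∑ y, ‖f y‖ ^ r ≤ 1)
    (hg : ∑ x, ‖g x‖ ^ s ≤ 1) {l u : ℝ} (hl : 0 ≤ l) (hu : u ≤ 1) :
    BddAbove ((norm ∘ interpPairing r s A f g) ''
      Complex.HadamardThreeLines.verticalClosedStrip l u) := by
  refine ⟨∑ x, ∑ y, ‖A x y‖, ?_⟩
  rintro _ ⟨w, hw, rfl⟩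
  have hw' : l ≤ w.re ∧ w.re ≤ u := hw
  refine (norm_interpPairing_le r s A f g w).trans
    (Finset.sum_le_sum fun x _ => Finset.sum_le_sum fun y _ => ?_)
  have h1 : ‖f y‖ ^ (r * w.re) ≤ 1 := Real.rpow_le_one (norm_nonneg _)
    (norm_le_one_of_sum_rpow_le_one hr hf y) (mul_nonneg hr.le (by linarith))
  have h2 : ‖g x‖ ^ (s * (1 - w.re)) ≤ 1 := Real.rpow_le_one (norm_nonneg _)
    (norm_le_one_of_sum_rpow_le_one hs hg x) (mul_nonneg hs.le (by linarith))
  calc ‖A x y‖ * ‖f y‖ ^ (r * w.re) * ‖g x‖ ^ (s * (1 - w.re)) ≤ ‖A x y‖ * 1 * 1 := by gcongr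
    _ = ‖A x y‖ := by ring

theorem norm_interpPairing_le_of_re_eq_zero (hA : RowColBound M A) (hM : 0 ≤ M)
    (hg : ∑ x, ‖g x‖ ^ s ≤ 1) {w : ℂ} (hw : w.re = 0) : ‖interpPairing r s A f g w‖ ≤ M := by
  refine (norm_interpPairing_le r s A f g w).trans ?_
  calc ∑ x, ∑ y, ‖A x y‖ * ‖f y‖ ^ (r * w.re) * ‖g x‖ ^ (s * (1 - w.re))
      = ∑ x, (∑ y, ‖A x y‖) * ‖g x‖ ^ s := by simp [hw, Finset.sum_mul]
    _ ≤ ∑ x, M * ‖g x‖ ^ s := by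
        refine Finset.sum_le_sum fun x _ => ?_
        have := hA.1 x
        gcongr
    _ ≤ M := by rw [← Finset.mul_sum]; exact mul_le_of_le_one_right hM hg

theorem norm_interpPairing_le_of_re_eq_one (hA : RowColBound M A) (hM : 0 ≤ M)
    (hf : ∑ y, ‖f y‖ ^ r ≤ 1) {w : ℂ} (hw : w.re = 1) : ‖interpPairing r s A f g w‖ ≤ M := by
  refine (norm_interpPairing_le r s A f g w).trans ?_
  calc ∑ x, ∑ y, ‖A x y‖ * ‖f y‖ ^ (r * w.re) * ‖g x‖ ^ (s * (1 - w.re))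
      = ∑ y, (∑ x, ‖A x y‖) * ‖f y‖ ^ r := by
        rw [Finset.sum_comm]; simp [hw, Finset.sum_mul]
    _ ≤ ∑ y, M * ‖f y‖ ^ r := by
        refine Finset.sum_le_sum fun y _ => ?_
        have := hA.2 y
        gcongr
    _ ≤ M := by rw [← Finset.mul_sum]; exact mul_le_of_le_one_right hM hf

theorem sum_norm_interpPow_sq_le_one (hf : ∑ y, ‖f y‖ ^ r ≤ 1) {w : ℂ} (hw : w.re = 1 / 2) :
    ∑ y, ‖interpPow r (f y) w‖ ^ (2 : ℝ) ≤ 1 := by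
  refine (Finset.sum_le_sum fun y _ => ?_).trans hf
  calc ‖interpPow r (f y) w‖ ^ (2 : ℝ) ≤ (‖f y‖ ^ (r * w.re)) ^ (2 : ℝ) := by
        gcongr; exact norm_interpPow_le _ _ _
    _ = ‖f y‖ ^ r := by
        rw [← Real.rpow_mul (norm_nonneg _), hw]; congr 1; ring

theorem norm_interpPairing_le_of_re_eq_half (hA : LpBound 2 ε A) (hε : 0 ≤ ε)
    (hf : ∑ y, ‖f y‖ ^ r ≤ 1) (hg : ∑ x, ‖g x‖ ^ s ≤ 1) {w : ℂ} (hw : w.re = 1 / 2) :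
    ‖interpPairing r s A f g w‖ ≤ ε := by
  set f' : ι → ℂ := fun y => interpPow r (f y) w
  set g' : ι → ℂ := fun x => interpPow s (g x) (1 - w)
  have hf' : ∑ y, ‖f' y‖ ^ (2 : ℝ) ≤ 1 := sum_norm_interpPow_sq_le_one hf hw
  have hg' : ∑ y, ‖g' y‖ ^ (2 : ℝ) ≤ 1 :=
    sum_norm_interpPow_sq_le_one hg (by simp [hw]; norm_num)
  have h1 : interpPairing r s A f g w = ∑ x, (A.mulVec f') x * g' x := by
    simp only [interpPairing, Matrix.mulVec, dotProduct, Finset.sum_mul, f', g']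
  have h2 : ∑ x, ‖A.mulVec f' x‖ * ‖g' x‖ ≤
      (∑ x, ‖A.mulVec f' x‖ ^ (2 : ℝ)) ^ (1 / 2 : ℝ) * (∑ x, ‖g' x‖ ^ (2 : ℝ)) ^ (1 / 2 : ℝ) :=
    Real.inner_le_Lp_mul_Lq_of_nonneg Finset.univ Real.HolderConjugate.two_two
      (fun _ _ => norm_nonneg _) (fun _ _ => norm_nonneg _)
  have h3 : (∑ x, ‖A.mulVec f' x‖ ^ (2 : ℝ)) ≤ ε ^ (2 : ℝ) :=
    (hA f').trans (mul_le_of_le_one_right (by positivity) hf')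
  calc ‖interpPairing r s A f g w‖ ≤ ∑ x, ‖A.mulVec f' x‖ * ‖g' x‖ := by
        rw [h1]; exact (norm_sum_le _ _).trans_eq (by simp only [norm_mul])
    _ ≤ _ := h2
    _ ≤ (ε ^ (2 : ℝ)) ^ (1 / 2 : ℝ) * 1 ^ (1 / 2 : ℝ) := by gcongr
    _ = ε := by rw [← Real.rpow_mul hε]; norm_num

/-- Boundedness on `ℓ^r` by duality: it is enough to bound the pairing of `A f` with `g`, for `f`
and `g` in the unit balls of `ℓ^r` and of the dual space `ℓ^s`. -/
theorem lpBound_of_pairing_le (hrs : r.HolderConjugate s) {C : ℝ}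
    (h : ∀ f g : ι → ℂ, ∑ y, ‖f y‖ ^ r ≤ 1 → ∑ x, ‖g x‖ ^ s ≤ 1 →
      ‖∑ x, ∑ y, A x y * f y * g x‖ ≤ C) : LpBound r C A := by
  have hr : 0 < r := hrs.pos
  -- The estimate on the unit ball.
  have key : ∀ f : ι → ℂ, ∑ y, ‖f y‖ ^ r ≤ 1 → ∑ x, ‖(A.mulVec f) x‖ ^ r ≤ C ^ r := by
    intro f hf
    obtain ⟨φ, hφ, hφ'⟩ := (NNReal.isGreatest_Lp Finset.univ (fun x => ‖A.mulVec f x‖₊) hrs).1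
    have hφ1 : ∑ x, (φ x : ℝ) ^ s ≤ 1 := by exact_mod_cast hφ
    have hφ2 : ∑ x, ‖A.mulVec f x‖ * φ x = (∑ x, ‖A.mulVec f x‖ ^ r) ^ (1 / r) := by
      have := congrArg (fun t : NNReal => (t : ℝ)) hφ'
      simpa using this
    -- The phases of `g` cancel those of `A f`.
    set g : ι → ℂ := fun x => (φ x : ℂ) * ((starRingEnd ℂ) (A.mulVec f x) / (‖A.mulVec f x‖ : ℂ))
    have hg : ∑ x, ‖g x‖ ^ s ≤ 1 := by
      refine (Finset.sum_le_sum fun x _ => ?_).trans hφ1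
      refine Real.rpow_le_rpow (norm_nonneg _) ?_ hrs.symm.pos.le
      simp only [g, norm_mul, norm_div, Complex.norm_conj, Complex.norm_real, norm_norm]
      rw [Real.norm_of_nonneg (φ x).coe_nonneg]
      exact mul_le_of_le_one_right (φ x).2 (div_self_le_one _)
    have h1 : ∑ x, ∑ y, A x y * f y * g x = ((∑ x, ‖A.mulVec f x‖ * φ x : ℝ) : ℂ) := by
      push_cast
      refine Finset.sum_congr rfl fun x _ => ?_
      rw [← Finset.sum_mul]
      change A.mulVec f x * g x = _
      rcases eq_or_ne (A.mulVec f x) 0 with h0 | h0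
      · simp [h0]
      have h0' : (‖A.mulVec f x‖ : ℂ) ≠ 0 := by simpa using h0
      simp only [g]
      rw [mul_left_comm, ← mul_div_assoc, Complex.mul_conj, Complex.normSq_eq_norm_sq]
      push_cast
      field_simp
    have h2 := h f g hf hg
    rw [h1, Complex.norm_real, Real.norm_of_nonneg (by positivity), hφ2] at h2
    calc ∑ x, ‖(A.mulVec f) x‖ ^ r = ((∑ x, ‖A.mulVec f x‖ ^ r) ^ (1 / r)) ^ r := by
          rw [← Real.rpow_mul (by positivity), one_div_mul_cancel hr.ne', Real.rpow_one]
      _ ≤ C ^ r := Real.rpow_le_rpow (by positivity) h2 hr.le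
  intro f
  set t : ℝ := ∑ y, ‖f y‖ ^ r
  rcases (show 0 ≤ t by positivity).eq_or_lt with ht | ht
  · have hf : f = 0 := by
      funext y
      have := (Finset.sum_eq_zero_iff_of_nonneg (fun y _ => by positivity)).1 ht.symm y
        (Finset.mem_univ y)
      simpa using (Real.rpow_eq_zero (norm_nonneg _) hr.ne').1 this
    simp [hf, Real.zero_rpow hr.ne', ← ht]
  -- Rescale `f` to have norm one.
  set a : ℝ := t ^ (-(1 / r))
  have ha : 0 < a := by positivity
  have har : a ^ r = t⁻¹ := by
    rw [← Real.rpow_mul ht.le, neg_mul, one_div_mul_cancel hr.ne', Real.rpow_neg_one]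
  have hn : ∀ z : ℂ, ‖(a : ℂ) * z‖ ^ r = t⁻¹ * ‖z‖ ^ r := by
    intro z
    rw [norm_mul, Complex.norm_real, Real.norm_of_nonneg ha.le,
      Real.mul_rpow ha.le (norm_nonneg _), har]
  have h1 := key (fun y => (a : ℂ) * f y) (by
    simp only [hn, ← Finset.mul_sum]
    exact (inv_mul_cancel₀ ht.ne').le)
  have h2 : A.mulVec (fun y => (a : ℂ) * f y) = fun x => (a : ℂ) * A.mulVec f x := by
    have := A.mulVec_smul (a : ℂ) f
    exact this
  rw [h2] at h1
  simp only [hn, ← Finset.mul_sum] at h1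
  rwa [inv_mul_le_iff₀ ht, mul_comm] at h1

theorem diffContOnCl_interpPairing (l u : ℝ) : DiffContOnCl ℂ (interpPairing r s A f g)
    (Complex.HadamardThreeLines.verticalStrip l u) :=
  (differentiable_interpPairing r s A f g).diffContOnCl

theorem interpPairing_inv (hrs : r.HolderConjugate s) :
    interpPairing r s A f g ((1 / r : ℝ) : ℂ) = ∑ x, ∑ y, A x y * f y * g x := by
  have h : (1 : ℂ) - ((1 / r : ℝ) : ℂ) = ((1 / s : ℝ) : ℂ) := by
    have := hrs.inv_add_inv_eq_one
    rw [← Complex.ofReal_one, ← Complex.ofReal_sub]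
    congr 1
    simp only [one_div]
    linarith
  simp only [interpPairing, h, interpPow_inv hrs.pos.ne', interpPow_inv hrs.symm.pos.ne']

/-- **Schur's test**: interpolation between `ℓ^∞` and `ℓ^1`. -/
theorem lpBound_of_rowColBound (hr : 1 < r) (hM : 0 < M) (hA : RowColBound M A) :
    LpBound r M A := by
  have hrs := Real.HolderConjugate.conjExponent hr
  refine lpBound_of_pairing_le hrs fun f g hf hg => ?_
  rw [← interpPairing_inv hrs]
  have hz : ((1 / r : ℝ) : ℂ) ∈ Complex.HadamardThreeLines.verticalClosedStrip 0 1 := by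
    have : 1 / r ≤ 1 := (div_le_one hrs.pos).2 hr.le
    exact ⟨by simpa using hrs.pos.le, by simpa using this⟩
  have h := Complex.HadamardThreeLines.norm_le_interp_of_mem_verticalClosedStrip' zero_lt_one hz
    (diffContOnCl_interpPairing 0 1)
    (bddAbove_interpPairing (A := A) hrs.pos hrs.symm.pos hf hg le_rfl le_rfl)
    (fun w hw => norm_interpPairing_le_of_re_eq_zero hA hM.le hg hw)
    (fun w hw => norm_interpPairing_le_of_re_eq_one hA hM.le hf hw)
  refine h.trans_eq ?_
  rw [← Real.rpow_add hM, sub_add_cancel, Real.rpow_one]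

/-- **Riesz–Thorin interpolation** for finite matrices, between `ℓ^2` and whichever of `ℓ^1` and
`ℓ^∞` lies on the side of `r`: the exponent `θ` depends only on `r`. -/
theorem exists_lpBound_of_rowColBound_of_lpBound_two (hr : 1 < r) :
    ∃ θ : ℝ, 0 < θ ∧ ∀ {ι : Type*} [Fintype ι] (A : Matrix ι ι ℂ) (M ε : ℝ), 0 ≤ M → 0 ≤ ε →
      RowColBound M A → LpBound 2 ε A → LpBound r (M ^ (1 - θ) * ε ^ θ) A := by
  have hrs := Real.HolderConjugate.conjExponent hr
  have hr0 := hrs.pos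
  rcases le_total r 2 with h2 | h2
  · have hz : ((1 / r : ℝ) : ℂ) ∈ Complex.HadamardThreeLines.verticalClosedStrip (1 / 2) 1 := by
      have h3 : 1 / r ≤ 1 := (div_le_one hrs.pos).2 hr.le
      have h4 : 1 / 2 ≤ 1 / r := one_div_le_one_div_of_le hr0 h2
      exact ⟨by simpa using h4, by simpa using h3⟩
    refine ⟨2 - 2 / r, by rw [sub_pos, div_lt_iff₀ hr0]; linarith, ?_⟩
    intro ι _ A M ε hM hε hA hA2
    refine lpBound_of_pairing_le hrs fun f g hf hg => ?_
    rw [← interpPairing_inv hrs]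
    have h := Complex.HadamardThreeLines.norm_le_interp_of_mem_verticalClosedStrip'
      one_half_lt_one hz (diffContOnCl_interpPairing (1 / 2) 1)
      (bddAbove_interpPairing (A := A) hrs.pos hrs.symm.pos hf hg one_half_pos.le le_rfl)
      (fun w hw => norm_interpPairing_le_of_re_eq_half hA2 hε hf hg hw)
      (fun w hw => norm_interpPairing_le_of_re_eq_one hA hM hf hw)
    refine h.trans_eq ?_
    rw [mul_comm, Complex.ofReal_re]
    congr 2 <;> ring
  · have hz : ((1 / r : ℝ) : ℂ) ∈ Complex.HadamardThreeLines.verticalClosedStrip 0 (1 / 2) := by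
      have h4 : 1 / r ≤ 1 / 2 := one_div_le_one_div_of_le two_pos h2
      exact ⟨by simpa using hr0.le, by simpa using h4⟩
    refine ⟨2 / r, by positivity, ?_⟩
    intro ι _ A M ε hM hε hA hA2
    refine lpBound_of_pairing_le hrs fun f g hf hg => ?_
    rw [← interpPairing_inv hrs]
    have h := Complex.HadamardThreeLines.norm_le_interp_of_mem_verticalClosedStrip'
      one_half_pos hz (diffContOnCl_interpPairing 0 (1 / 2))
      (bddAbove_interpPairing (A := A) hrs.pos hrs.symm.pos hf hg le_rfl one_half_lt_one.le)
      (fun w hw => norm_interpPairing_le_of_re_eq_zero hA hM hg hw)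
      (fun w hw => norm_interpPairing_le_of_re_eq_half hA2 hε hf hg hw)
    refine h.trans_eq ?_
    rw [Complex.ofReal_re]
    congr 2 <;> ring

theorem LpBound.lpOpNorm_le {ι : Type*} [Finite ι] {p : ℝ≥0∞} [Fact (1 ≤ p)] (hp : p ≠ ∞)
    {A : Matrix ι ι ℂ} {C : ℝ} (hC : 0 ≤ C)
    (h : letI := Fintype.ofFinite ι; LpBound p.toReal C A) : lpOpNorm p A ≤ C := by
  let := Fintype.ofFinite ι
  let := Classical.decEq ι
  have hp0 : 0 < p.toReal :=
    ENNReal.toReal_pos (zero_lt_one.trans_le (Fact.out : 1 ≤ p)).ne' hp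
  refine ContinuousLinearMap.opNorm_le_bound _ hC fun v => ?_
  rw [PiLp.norm_eq_sum hp0, PiLp.norm_eq_sum hp0]
  calc _ ≤ (C ^ p.toReal * ∑ y, ‖v y‖ ^ p.toReal) ^ (1 / p.toReal) := by
        gcongr
        exact h v.ofLp
    _ = _ := by
        rw [Real.mul_rpow (by positivity) (by positivity), ← Real.rpow_mul hC,
          mul_one_div_cancel hp0.ne', Real.rpow_one]

end Interpolation

/-! ### Uniform spectral gap from property (T) -/

section Kazhdan

universe u

/-- In a unitary representation, averaging over a finite set that contains `1` and an element moving
`v` by at least `ε ‖v‖` contracts `v`, by the parallelogram law. -/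
theorem norm_sum_unitary_le {G : Type*} [Group G] {H : Type*} [NormedAddCommGroup H]
    [InnerProductSpace ℂ H] (π : G →* (H ≃ₗᵢ[ℂ] H)) {K : Finset G} (h1 : 1 ∈ K) {ε : ℝ}
    (hε : 0 < ε) {v : H} {g : G} (hg : g ∈ K) (hg1 : g ≠ 1) (hv : ε * ‖v‖ ≤ ‖π g v - v‖) :
    ‖∑ h ∈ K, π h v‖ ≤ (√(4 - ε ^ 2) + (K.card - 2)) * ‖v‖ := by
  classical
  have hn : ‖π g v‖ = ‖v‖ := (π g).norm_map v
  have hpar := parallelogram_law_with_norm ℂ (π g v) v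
  have h2 : ‖π g v + v‖ ≤ √(4 - ε ^ 2) * ‖v‖ := by
    rw [← Real.sqrt_sq (norm_nonneg v), ← Real.sqrt_mul' _ (sq_nonneg _)]
    refine Real.le_sqrt_of_sq_le ?_
    have h3 : (ε * ‖v‖) ^ 2 ≤ ‖π g v - v‖ ^ 2 := by gcongr
    rw [hn] at hpar
    nlinarith
  have hg' : g ∈ K.erase 1 := Finset.mem_erase.2 ⟨hg1, hg⟩
  have hcard : (((K.erase 1).erase g).card : ℝ) = K.card - 2 := by
    have h4 := Finset.card_erase_add_one h1
    have h5 := Finset.card_erase_add_one hg'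
    have h6 : ((K.erase 1).erase g).card + 2 = K.card := by omega
    rw [← h6]; push_cast; ring
  rw [← Finset.add_sum_erase _ _ h1, ← Finset.add_sum_erase _ _ hg', ← add_assoc, map_one]
  refine (norm_add_le _ _).trans ?_
  rw [add_mul]
  refine add_le_add ?_ ?_
  · rw [add_comm]; exact h2
  · refine (norm_sum_le _ _).trans_eq ?_
    simp only [LinearIsometryEquiv.norm_map, Finset.sum_const, nsmul_eq_mul, hcard]

/-- Property (T) as a uniform spectral gap: one average over a finite set contracts, by one constant,
every unitary representation without nonzero invariant vectors. -/
theorem HasPropertyT.exists_average_contraction {G : Type u} [Group G] (hT : HasPropertyT G) :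
    ∃ (K : Finset G) (c : ℝ), K.Nonempty ∧ 0 ≤ c ∧ c < 1 ∧
      ∀ (H : Type u) [NormedAddCommGroup H] [InnerProductSpace ℂ H] [CompleteSpace H]
        (π : G →* (H ≃ₗᵢ[ℂ] H)), (∀ v : H, (∀ g, π g v = v) → v = 0) →
        ∀ v : H, ‖∑ g ∈ K, π g v‖ ≤ c * K.card * ‖v‖ := by
  classical
  obtain ⟨K, ε, hε, h⟩ := hT
  -- Adjoining `1` makes the average see `v` itself next to the translate `π g v` that differs from it.
  set K' := insert 1 K
  have hK' : K'.Nonempty := Finset.insert_nonempty _ _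
  have hcard : (0 : ℝ) < K'.card := by exact_mod_cast hK'.card_pos
  have hs : √(4 - ε ^ 2) < 2 := by
    rw [Real.sqrt_lt' two_pos]
    have : 0 < ε ^ 2 := by positivity
    linarith
  -- The quotient may be negative when `K'` is small and `ε` is large, hence the maximum.
  refine ⟨K', max 0 ((√(4 - ε ^ 2) + (K'.card - 2)) / K'.card), hK', le_max_left _ _,
    max_lt one_pos ?_, ?_⟩
  · rw [div_lt_one hcard]; linarith
  intro H _ _ _ π hπ v
  rcases eq_or_ne v 0 with rfl | hv
  · simp
  have hmove : ∃ g ∈ K, ε * ‖v‖ ≤ ‖π g v - v‖ := by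
    by_contra! hc
    obtain ⟨w, hw, hw'⟩ := h H π ⟨v, hv, hc⟩
    exact hw (hπ w hw')
  obtain ⟨g, hg, hgv⟩ := hmove
  have hg1 : g ≠ 1 := by
    rintro rfl
    have : 0 < ε * ‖v‖ := mul_pos hε (norm_pos_iff.2 hv)
    simp at hgv
    linarith
  refine (norm_sum_unitary_le π (Finset.mem_insert_self _ _) hε (Finset.mem_insert_of_mem hg) hg1
    hgv).trans ?_
  gcongr
  rw [← div_le_iff₀ hcard]
  exact le_max_right _ _

end Kazhdan

/-! ### Regular representations of finite quotients -/

section Regular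

universe u

variable {G : Type u} [Group G] (N : Subgroup G) [N.Normal]

/-- The Hilbert space of functions of sum zero on a finite set. -/
def sumZero (Q : Type*) [Fintype Q] : Submodule ℂ (EuclideanSpace ℂ Q) where
  carrier := {v | ∑ x, v x = 0}
  add_mem' {v w} hv hw := by
    change ∑ x, (v x + w x) = 0
    rw [Finset.sum_add_distrib, show ∑ x, v x = 0 from hv, show ∑ x, w x = 0 from hw, add_zero]
  zero_mem' := by simp
  smul_mem' c v hv := by
    change ∑ x, c * v x = 0
    rw [← Finset.mul_sum, show ∑ x, v x = 0 from hv, mul_zero]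

/-- Unitary representations of `G` on `H`. Stating the type for a general `H` fixes the path to the
module structure of `H`, through its inner product, that `HasPropertyT` uses. -/
abbrev UnitaryRep (G H : Type*) [Group G] [NormedAddCommGroup H] [InnerProductSpace ℂ H] :=
  G →* (H ≃ₗᵢ[ℂ] H)

variable {N} in
/-- Right translation by `g` on the functions of sum zero on `G ⧸ N`. -/
noncomputable def rightTranslation [Fintype (G ⧸ N)] :
    UnitaryRep G (sumZero (G ⧸ N)) where
  toFun g :=
    { toFun := fun v => ⟨WithLp.toLp 2 fun x => v.1 (x * (g : G ⧸ N)), by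
        change ∑ x, v.1 (x * (g : G ⧸ N)) = 0
        exact (Equiv.sum_comp (Equiv.mulRight (g : G ⧸ N)) v.1).trans v.2⟩
      invFun := fun v => ⟨WithLp.toLp 2 fun x => v.1 (x * (g : G ⧸ N)⁻¹), by
        change ∑ x, v.1 (x * (g : G ⧸ N)⁻¹) = 0
        exact (Equiv.sum_comp (Equiv.mulRight (g : G ⧸ N)⁻¹) v.1).trans v.2⟩
      left_inv := fun v => by ext x; simp
      right_inv := fun v => by ext x; simp
      map_add' := fun v w => by ext x; simp
      map_smul' := fun c v => by ext x; simp
      norm_map' := fun v => by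
        change ‖WithLp.toLp 2 fun x => v.1 (x * (g : G ⧸ N))‖ = ‖v.1‖
        rw [EuclideanSpace.norm_eq, EuclideanSpace.norm_eq]
        congr 1
        exact Equiv.sum_comp (Equiv.mulRight (g : G ⧸ N)) fun x => ‖v.1 x‖ ^ 2 }
  map_one' := by ext v x; simp
  map_mul' g h := by
    ext v x
    change v.1 (x * ((g * h : G) : G ⧸ N)) = v.1 (x * (g : G ⧸ N) * (h : G ⧸ N))
    rw [QuotientGroup.mk_mul, mul_assoc]

variable {N} in
theorem rightTranslation_apply [Fintype (G ⧸ N)] (g : G) (v : sumZero (G ⧸ N)) (x : G ⧸ N) :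
    (rightTranslation g v).1 x = v.1 (x * (g : G ⧸ N)) := rfl

variable {N} in
/-- A function on `G ⧸ N` that is invariant under translation is constant, hence vanishes if its sum
is zero. -/
theorem eq_zero_of_rightTranslation_eq [Fintype (G ⧸ N)] {v : sumZero (G ⧸ N)}
    (hv : ∀ g : G, rightTranslation g v = v) : v = 0 := by
  have h1 : ∀ x, v.1 x = v.1 1 := by
    intro x
    obtain ⟨g, rfl⟩ := QuotientGroup.mk_surjective x
    have := congrArg (fun w : sumZero (G ⧸ N) => w.1 1) (hv g)
    simpa [rightTranslation_apply] using this
  have h2 : ∑ x, v.1 x = 0 := v.2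
  simp only [h1, Finset.sum_const, Finset.card_univ, nsmul_eq_mul, mul_eq_zero,
    Nat.cast_eq_zero, Fintype.card_ne_zero, false_or] at h2
  ext x
  rw [h1 x, h2]
  rfl

theorem norm_sq_sumZero {Q : Type*} [Fintype Q] (w : sumZero Q) : ‖w‖ ^ 2 = ∑ x, ‖w.1 x‖ ^ 2 :=
  EuclideanSpace.norm_sq_eq w.1

variable {N} in
theorem sum_rightTranslation_apply [Fintype (G ⧸ N)] (K : Finset G) (w : sumZero (G ⧸ N))
    (x : G ⧸ N) :
    (∑ g ∈ K, rightTranslation g w).1 x = ∑ g ∈ K, w.1 (x * (g : G ⧸ N)) := by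
  rw [Submodule.coe_sum, WithLp.ofLp_sum, Finset.sum_apply]
  rfl

open scoped Classical in
/-- The matrices of the right regular representation of `G` on functions on `G ⧸ N`. -/
noncomputable def regularRep [Fintype (G ⧸ N)] : G →* Matrix (G ⧸ N) (G ⧸ N) ℂ where
  toFun g := Matrix.of fun x y => if x * (g : G ⧸ N) = y then 1 else 0
  map_one' := by ext x y; simp [Matrix.one_apply]
  map_mul' g h := by
    ext x y
    simp only [Matrix.mul_apply, Matrix.of_apply, ite_mul, one_mul, zero_mul, Finset.sum_ite_eq,
      Finset.mem_univ, if_true, QuotientGroup.mk_mul, mul_assoc]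
    congr

open scoped Classical in
theorem regularRep_apply [Fintype (G ⧸ N)] (g : G) (x y : G ⧸ N) :
    regularRep N g x y = if x * (g : G ⧸ N) = y then 1 else 0 := rfl

theorem regularRep_mulVec [Fintype (G ⧸ N)] (g : G) (v : G ⧸ N → ℂ) (x : G ⧸ N) :
    (regularRep N g).mulVec v x = v (x * (g : G ⧸ N)) := by
  classical
  simp [Matrix.mulVec, dotProduct, regularRep_apply]

open scoped Classical in
theorem regularMatrix_eq_lift [Fintype (G ⧸ N)] (f : MonoidAlgebra ℝ G) :
    regularMatrix N f = MonoidAlgebra.lift ℝ (Matrix (G ⧸ N) (G ⧸ N) ℂ) G (regularRep N) f := by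
  rw [MonoidAlgebra.lift_apply]
  ext x y
  rw [Finsupp.sum, Matrix.sum_apply]
  refine Finset.sum_congr rfl fun g _ => ?_
  rw [Matrix.smul_apply, regularRep_apply]
  split_ifs <;> simp

open scoped Classical in
theorem regularMatrix_pow [Fintype (G ⧸ N)] (f : MonoidAlgebra ℝ G) (n : ℕ) :
    regularMatrix N (f ^ n) = regularMatrix N f ^ n := by
  rw [regularMatrix_eq_lift, regularMatrix_eq_lift, map_pow]

end Regular

/-! ### Powers of averaging operators -/

section RowCol

variable {ι : Type*} [Fintype ι] {A B : Matrix ι ι ℂ} {M M' : ℝ}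

theorem RowColBound.mul (hM' : 0 ≤ M') (hA : RowColBound M A) (hM : 0 ≤ M)
    (hB : RowColBound M' B) : RowColBound (M * M') (A * B) := by
  have h : ∀ x z, ‖(A * B) x z‖ ≤ ∑ y, ‖A x y‖ * ‖B y z‖ := fun x z => by
    rw [Matrix.mul_apply]
    exact (norm_sum_le _ _).trans_eq (by simp only [norm_mul])
  constructor
  · intro x
    refine (Finset.sum_le_sum fun z _ => h x z).trans ?_
    rw [Finset.sum_comm]
    simp only [← Finset.mul_sum]
    refine (Finset.sum_le_sum fun y _ =>
      mul_le_mul_of_nonneg_left (hB.1 y) (norm_nonneg _)).trans ?_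
    rw [← Finset.sum_mul]
    exact mul_le_mul_of_nonneg_right (hA.1 x) hM'
  · intro z
    refine (Finset.sum_le_sum fun x _ => h x z).trans ?_
    rw [Finset.sum_comm]
    simp only [← Finset.sum_mul]
    refine (Finset.sum_le_sum fun y _ =>
      mul_le_mul_of_nonneg_right (hA.2 y) (norm_nonneg _)).trans ?_
    rw [← Finset.mul_sum]
    exact mul_le_mul_of_nonneg_left (hB.2 z) hM

theorem rowColBound_one [DecidableEq ι] : RowColBound 1 (1 : Matrix ι ι ℂ) := by
  constructor <;> intro x <;> simp [Matrix.one_apply, apply_ite]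

theorem RowColBound.pow [DecidableEq ι] (hA : RowColBound 1 A) (n : ℕ) :
    RowColBound 1 (A ^ n) := by
  induction n with
  | zero => simpa using rowColBound_one
  | succ n ih => simpa [pow_succ] using ih.mul zero_le_one zero_le_one hA

theorem RowColBound.sub (hA : RowColBound M A) (hB : RowColBound M' B) :
    RowColBound (M + M') (A - B) := by
  constructor <;> intro x
  · refine (Finset.sum_le_sum fun y _ => norm_sub_le (A x y) (B x y)).trans ?_
    rw [Finset.sum_add_distrib]
    exact add_le_add (hA.1 x) (hB.1 x)
  · refine (Finset.sum_le_sum fun y _ => norm_sub_le (A y x) (B y x)).trans ?_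
    rw [Finset.sum_add_distrib]
    exact add_le_add (hA.2 x) (hB.2 x)

end RowCol

section Averaging

universe u

variable {G : Type u} [Group G] (N : Subgroup G)

theorem card_quotient_eq_index [Fintype (G ⧸ N)] : Fintype.card (G ⧸ N) = N.index := by
  rw [Subgroup.index, Nat.card_eq_fintype_card]

theorem index_cast_ne_zero [Fintype (G ⧸ N)] : (N.index : ℂ) ≠ 0 := by
  rw [← card_quotient_eq_index]
  exact_mod_cast Fintype.card_ne_zero

theorem averagingMatrix_mulVec [Fintype (G ⧸ N)] (v : G ⧸ N → ℂ) (x : G ⧸ N) :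
    (averagingMatrix N).mulVec v x = (1 / (N.index : ℂ)) * ∑ y, v y := by
  simp [Matrix.mulVec, dotProduct, averagingMatrix, Finset.mul_sum]

theorem rowColBound_averagingMatrix [Fintype (G ⧸ N)] : RowColBound 1 (averagingMatrix N) := by
  have h : (N.index : ℝ) ≠ 0 := by exact_mod_cast index_cast_ne_zero N
  constructor <;> intro x <;> simp [averagingMatrix, card_quotient_eq_index, h]

/-- The sum of `|v - m|²`, for `m` the mean of `v`, is at most the sum of `|v|²`. -/
theorem sum_norm_sub_averaging_sq_le [Fintype (G ⧸ N)] (v : G ⧸ N → ℂ) :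
    ∑ x, ‖(v - (averagingMatrix N).mulVec v) x‖ ^ 2 ≤ ∑ x, ‖v x‖ ^ 2 := by
  set m : ℂ := (1 / (N.index : ℂ)) * ∑ y, v y
  have hm : ∑ y, v y = N.index * m := by
    simp only [m]; field_simp [index_cast_ne_zero N]
  have h1 : ∀ x, ‖(v - (averagingMatrix N).mulVec v) x‖ ^ 2 =
      ‖v x‖ ^ 2 + ‖m‖ ^ 2 - 2 * (v x * (starRingEnd ℂ) m).re := by
    intro x
    rw [Pi.sub_apply, averagingMatrix_mulVec, Complex.sq_norm, Complex.normSq_sub, Complex.sq_norm,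
      Complex.sq_norm]
  have h2 : ∑ x, (v x * (starRingEnd ℂ) m).re = N.index * ‖m‖ ^ 2 := by
    rw [← Complex.re_sum, ← Finset.sum_mul, hm, mul_assoc, Complex.mul_conj, ← Complex.sq_norm,
      ← Complex.ofReal_natCast, ← Complex.ofReal_mul, Complex.ofReal_re]
  simp only [h1]
  rw [Finset.sum_sub_distrib, Finset.sum_add_distrib, ← Finset.mul_sum, h2, Finset.sum_const,
    Finset.card_univ, card_quotient_eq_index, nsmul_eq_mul]
  have : 0 ≤ (N.index : ℝ) * ‖m‖ ^ 2 := by positivity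
  linarith

/-- The contraction of the sum-zero part, iterated. -/
theorem sum_norm_pow_mulVec_sq_le {ι : Type*} [Fintype ι] [DecidableEq ι] {A : Matrix ι ι ℂ} {c : ℝ}
    (hA : ∀ v : ι → ℂ, ∑ x, v x = 0 → ∑ x, A.mulVec v x = 0)
    (hc : ∀ v : ι → ℂ, ∑ x, v x = 0 → ∑ x, ‖A.mulVec v x‖ ^ 2 ≤ c ^ 2 * ∑ x, ‖v x‖ ^ 2)
    (n : ℕ) : ∀ v : ι → ℂ, ∑ x, v x = 0 →
      ∑ x, ‖(A ^ n).mulVec v x‖ ^ 2 ≤ (c ^ n) ^ 2 * ∑ x, ‖v x‖ ^ 2 := by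
  induction n with
  | zero => intro v _; simp
  | succ n ih =>
    intro v hv
    rw [pow_succ, ← Matrix.mulVec_mulVec]
    refine (ih _ (hA v hv)).trans ?_
    refine (mul_le_mul_of_nonneg_left (hc v hv) (sq_nonneg _)).trans_eq ?_
    ring

/-- If `A` fixes the constants and contracts the functions of sum zero, then the powers of `A`
converge to the averaging projection. -/
theorem lpBound_two_pow_sub_averaging [Fintype (G ⧸ N)] [DecidableEq (G ⧸ N)]
    {A : Matrix (G ⧸ N) (G ⧸ N) ℂ} {c : ℝ} (h1 : ∀ a : ℂ, A.mulVec (fun _ => a) = fun _ => a)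
    (hA : ∀ v : G ⧸ N → ℂ, ∑ x, v x = 0 → ∑ x, A.mulVec v x = 0)
    (hc : ∀ v : G ⧸ N → ℂ, ∑ x, v x = 0 → ∑ x, ‖A.mulVec v x‖ ^ 2 ≤ c ^ 2 * ∑ x, ‖v x‖ ^ 2)
    (n : ℕ) : LpBound 2 (c ^ n) (A ^ n - averagingMatrix N) := by
  intro v
  have hconst : ∀ a : ℂ, (A ^ n).mulVec (fun _ => a) = fun _ => a := by
    intro a
    induction n with
    | zero => simp
    | succ n ih => rw [pow_succ, ← Matrix.mulVec_mulVec, h1, ih]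
  set m := (averagingMatrix N).mulVec v
  have hm : m = fun _ => (1 / (N.index : ℂ)) * ∑ y, v y :=
    funext fun x => averagingMatrix_mulVec N v x
  have h2 : (A ^ n - averagingMatrix N).mulVec v = (A ^ n).mulVec (v - m) := by
    rw [Matrix.sub_mulVec, Matrix.mulVec_sub]
    congr 1
    rw [hm, hconst, ← hm]
  have h3 : ∑ x, (v - m) x = 0 := by
    have := index_cast_ne_zero N
    simp only [Pi.sub_apply, hm, Finset.sum_sub_distrib, Finset.sum_const, Finset.card_univ,
      card_quotient_eq_index, nsmul_eq_mul]
    field_simp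
    ring
  rw [h2]
  simp only [Real.rpow_two]
  refine (sum_norm_pow_mulVec_sq_le hA hc n _ h3).trans ?_
  exact mul_le_mul_of_nonneg_left (sum_norm_sub_averaging_sq_le N v) (sq_nonneg _)

end Averaging

section UniformMeasure

universe u

variable {G : Type u} [Group G]

/-- The uniform probability measure on a finite set `K`, as an element of the group ring. -/
noncomputable def uniformMeasure (K : Finset G) : MonoidAlgebra ℝ G :=
  (K.card : ℝ)⁻¹ • ∑ g ∈ K, MonoidAlgebra.single g 1

open scoped Classical in
theorem uniformMeasure_coeff (K : Finset G) (g : G) :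
    (uniformMeasure K).coeff g = if g ∈ K then (K.card : ℝ)⁻¹ else 0 := by
  simp [uniformMeasure, MonoidAlgebra.coeff_sum, Finsupp.single_apply]

theorem uniformMeasure_nonneg (K : Finset G) (g : G) : 0 ≤ (uniformMeasure K).coeff g := by
  classical
  rw [uniformMeasure_coeff]
  split_ifs <;> positivity

theorem sum_uniformMeasure {K : Finset G} (hK : K.Nonempty) :
    ∑ g ∈ (uniformMeasure K).coeff.support, (uniformMeasure K).coeff g = 1 := by
  classical
  have h : (uniformMeasure K).coeff.support ⊆ K := by
    intro g hg
    rw [Finsupp.mem_support_iff, uniformMeasure_coeff] at hg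
    by_contra hc
    exact hg (if_neg hc)
  rw [Finset.sum_subset h fun g _ hg => by simpa using hg]
  have h0 : (K.card : ℝ) ≠ 0 := by exact_mod_cast hK.card_pos.ne'
  rw [Finset.sum_congr rfl fun g hg => (uniformMeasure_coeff K g).trans (if_pos hg)]
  simp [h0]

variable (N : Subgroup G) [N.Normal] [Fintype (G ⧸ N)] {K : Finset G}

theorem regularMatrix_uniformMeasure (K : Finset G) :
    regularMatrix N (uniformMeasure K) = (K.card : ℝ)⁻¹ • ∑ g ∈ K, regularRep N g := by
  classical
  rw [regularMatrix_eq_lift, uniformMeasure, map_smul, map_sum]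
  simp [MonoidAlgebra.lift_single]

theorem regularMatrix_uniformMeasure_mulVec (K : Finset G) (v : G ⧸ N → ℂ) (x : G ⧸ N) :
    (regularMatrix N (uniformMeasure K)).mulVec v x =
      (K.card : ℝ)⁻¹ • ∑ g ∈ K, v (x * (g : G ⧸ N)) := by
  rw [regularMatrix_uniformMeasure, Matrix.smul_mulVec, Matrix.sum_mulVec, Pi.smul_apply,
    Finset.sum_apply]
  simp only [regularRep_mulVec]

theorem rowColBound_regularMatrix_uniformMeasure (hK : K.Nonempty) :
    RowColBound 1 (regularMatrix N (uniformMeasure K)) := by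
  classical
  have h0 : (K.card : ℝ) ≠ 0 := by exact_mod_cast hK.card_pos.ne'
  have h : ∀ x y, ‖regularMatrix N (uniformMeasure K) x y‖ ≤
      (K.card : ℝ)⁻¹ * ∑ g ∈ K, if x * (g : G ⧸ N) = y then 1 else 0 := by
    intro x y
    rw [regularMatrix_uniformMeasure, Matrix.smul_apply, Matrix.sum_apply, norm_smul, norm_inv,
      Real.norm_natCast]
    gcongr
    refine (norm_sum_le _ _).trans (Finset.sum_le_sum fun g _ => ?_)
    rw [regularRep_apply]
    split_ifs <;> simp
  constructor
  · intro x
    refine (Finset.sum_le_sum fun y _ => h x y).trans_eq ?_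
    rw [← Finset.mul_sum, Finset.sum_comm]
    simp [h0]
  · intro y
    refine (Finset.sum_le_sum fun x _ => h x y).trans_eq ?_
    rw [← Finset.mul_sum, Finset.sum_comm]
    simp [h0, eq_mul_inv_iff_mul_eq.symm]

theorem regularMatrix_uniformMeasure_mulVec_const (hK : K.Nonempty) (a : ℂ) :
    (regularMatrix N (uniformMeasure K)).mulVec (fun _ => a) = fun _ => a := by
  have h0 : (K.card : ℂ) ≠ 0 := by exact_mod_cast hK.card_pos.ne'
  funext x
  rw [regularMatrix_uniformMeasure_mulVec]
  simp [h0]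

theorem sum_regularMatrix_uniformMeasure_mulVec {v : G ⧸ N → ℂ} (hv : ∑ x, v x = 0) :
    ∑ x, (regularMatrix N (uniformMeasure K)).mulVec v x = 0 := by
  simp only [regularMatrix_uniformMeasure_mulVec]
  rw [← Finset.smul_sum, Finset.sum_comm]
  have h : ∀ g : G, ∑ x, v (x * (g : G ⧸ N)) = 0 := fun g =>
    (Equiv.sum_comp (Equiv.mulRight (g : G ⧸ N)) v).trans hv
  simp [h]

end UniformMeasure

universe u

/-- For a group with property (T), the convolution powers of a suitable finitely supported
probability measure converge in the regular representation on `ℓ^r(G ⧸ N)` to the averaging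
projection, uniformly over the normal subgroups `N` of finite index. The measure does not depend on
the exponent `1 < r < ∞`. -/
theorem HasPropertyT.exists_measure {G : Type u} [Group G] (hT : HasPropertyT G) :
    ∃ μ : MonoidAlgebra ℝ G, (∀ g, 0 ≤ μ.coeff g) ∧ (∑ g ∈ μ.coeff.support, μ.coeff g = 1) ∧
      (∀ (N : Subgroup G) [N.Normal] [Fintype (G ⧸ N)] (n : ℕ),
        RowColBound 1 (regularMatrix N (μ ^ n))) ∧
      ∀ r : ℝ, 1 < r → ∀ ε : ℝ, 0 < ε → ∃ n₀ : ℕ, ∀ n ≥ n₀,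
        ∀ (N : Subgroup G) [N.Normal] [Fintype (G ⧸ N)],
          LpBound r ε (regularMatrix N (μ ^ n) - averagingMatrix N) := by
  classical
  obtain ⟨K, c, hK, hc0, hc1, hgap⟩ := hT.exists_average_contraction
  have hk : (0 : ℝ) < K.card := by exact_mod_cast hK.card_pos
  have hrow : ∀ (N : Subgroup G) [N.Normal] [Fintype (G ⧸ N)] (n : ℕ),
      RowColBound 1 (regularMatrix N (uniformMeasure K ^ n)) := by
    intro N _ _ n
    rw [regularMatrix_pow]
    exact (rowColBound_regularMatrix_uniformMeasure N hK).pow n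
  have htwo : ∀ (N : Subgroup G) [N.Normal] [Fintype (G ⧸ N)] (n : ℕ),
      LpBound 2 (c ^ n) (regularMatrix N (uniformMeasure K ^ n) - averagingMatrix N) := by
    intro N _ _ n
    rw [regularMatrix_pow]
    refine lpBound_two_pow_sub_averaging N (regularMatrix_uniformMeasure_mulVec_const N hK)
      (fun v hv => sum_regularMatrix_uniformMeasure_mulVec N hv) (fun v hv => ?_) n
    -- The functions of sum zero form a unitary representation without invariant vectors.
    let w : sumZero (G ⧸ N) := ⟨WithLp.toLp 2 v, hv⟩
    have h1 : ‖∑ g ∈ K, rightTranslation g w‖ ≤ c * K.card * ‖w‖ :=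
      hgap (sumZero (G ⧸ N)) rightTranslation (fun _ h => eq_zero_of_rightTranslation_eq h) w
    have h3 : ‖w‖ ^ 2 = ∑ x, ‖v x‖ ^ 2 := norm_sq_sumZero w
    have h4 : ‖∑ g ∈ K, rightTranslation g w‖ ^ 2 =
        ∑ x, ‖∑ g ∈ K, v (x * (g : G ⧸ N))‖ ^ 2 := by
      rw [norm_sq_sumZero]
      simp only [sum_rightTranslation_apply]
      rfl
    have h5 : ∀ x, ‖(regularMatrix N (uniformMeasure K)).mulVec v x‖ ^ 2 =
        ((K.card : ℝ)⁻¹) ^ 2 * ‖∑ g ∈ K, v (x * (g : G ⧸ N))‖ ^ 2 := by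
      intro x
      rw [regularMatrix_uniformMeasure_mulVec, norm_smul, mul_pow, norm_inv, Real.norm_natCast]
    simp only [h5, ← Finset.mul_sum]
    rw [← h4, ← h3, ← mul_pow, ← mul_pow]
    refine pow_le_pow_left₀ (by positivity) ?_ 2
    rw [inv_mul_le_iff₀ hk]
    exact h1.trans_eq (by ring)
  refine ⟨uniformMeasure K, uniformMeasure_nonneg K, sum_uniformMeasure hK, hrow, ?_⟩
  intro r hr ε hε
  obtain ⟨θ, hθ, hint⟩ := exists_lpBound_of_rowColBound_of_lpBound_two.{u} hr
  have hlim : Tendsto (fun n : ℕ => (2 : ℝ) ^ (1 - θ) * (c ^ n) ^ θ) atTop (𝓝 0) := by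
    have h1 : Tendsto (fun n : ℕ => (c ^ n) ^ θ) atTop (𝓝 (0 ^ θ)) :=
      ((Real.continuous_rpow_const hθ.le).tendsto 0).comp
        (tendsto_pow_atTop_nhds_zero_of_lt_one hc0 hc1)
    simpa [Real.zero_rpow hθ.ne'] using h1.const_mul ((2 : ℝ) ^ (1 - θ))
  obtain ⟨n₀, hn₀⟩ := eventually_atTop.1 (hlim.eventually (ge_mem_nhds hε))
  refine ⟨n₀, fun n hn N _ _ => fun f => ?_⟩
  have h2 : RowColBound 2 (regularMatrix N (uniformMeasure K ^ n) - averagingMatrix N) := by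
    have := (hrow N n).sub (rowColBound_averagingMatrix N)
    rwa [one_add_one_eq_two] at this
  refine (hint _ 2 (c ^ n) zero_le_two (by positivity) h2 (htwo N n) f).trans ?_
  have := hn₀ n hn
  gcongr

/-! ### Block diagonal operators tensored with an operator on `ℓ^p` -/

section BlockTensor

variable {p : ℝ≥0∞} [Fact (1 ≤ p)]

theorem toReal_pos_of_fact (hp : p ≠ ∞) : 0 < p.toReal :=
  ENNReal.toReal_pos (zero_lt_one.trans_le (Fact.out : 1 ≤ p)).ne' hp

/-- A matrix bounded on `ℓ^p(κ)` acts on `ℓ^p(κ, ℓ^p)` with the same bound: by Fubini, apply the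
scalar estimate in each coordinate of the values. -/
theorem LpBound.sum_norm_lp_le {κ : Type*} [Fintype κ] (hp : p ≠ ∞) {B : Matrix κ κ ℂ} {C : ℝ}
    (h : LpBound p.toReal C B) (η : κ → EllP p) :
    ∑ x, ‖∑ y, B x y • η y‖ ^ p.toReal ≤ C ^ p.toReal * ∑ y, ‖η y‖ ^ p.toReal := by
  have hr := toReal_pos_of_fact hp
  have hs : ∀ v : EllP p, Summable fun k => ‖v k‖ ^ p.toReal := fun v => (lp.memℓp v).summable hr
  simp only [lp.norm_rpow_eq_tsum hr]
  rw [← Summable.tsum_finsetSum fun x _ => hs _, ← Summable.tsum_finsetSum fun x _ => hs _,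
    ← tsum_mul_left]
  refine Summable.tsum_le_tsum (fun k => ?_) (summable_sum fun x _ => hs _)
    ((summable_sum fun x _ => hs _).mul_left _)
  have hk := h fun y => η y k
  have h1 : ∀ x, (∑ y, B x y • η y) k = B.mulVec (fun y => η y k) x := by
    intro x
    rw [lp.coeFn_sum, Finset.sum_apply]
    rfl
  simpa only [h1] using hk

variable {Z : Type*} {κ : ℕ → Type*}

theorem ext_blocks (e : Z ≃ Σ i, κ i) {ξ η : EllPOn p Z}
    (h : ∀ i x, ξ (e.symm ⟨i, x⟩) = η (e.symm ⟨i, x⟩)) : ξ = η := by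
  ext1
  funext z
  obtain ⟨⟨i, x⟩, rfl⟩ := e.symm.surjective z
  exact h i x

variable [∀ i, Fintype (κ i)]

theorem hasSum_blocks (e : Z ≃ Σ i, κ i) {h : Z → ℝ} (hh : Summable h) :
    HasSum (fun i => ∑ y, h (e.symm ⟨i, y⟩)) (∑' z, h z) := by
  have h1 : HasSum (fun q : Σ i, κ i => h (e.symm q)) (∑' z, h z) :=
    (e.symm.hasSum_iff).2 hh.hasSum
  exact h1.sigma fun i => hasSum_fintype _

theorem hasSum_blocks_norm (hp : p ≠ ∞) (e : Z ≃ Σ i, κ i) (ξ : EllPOn p Z) :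
    HasSum (fun i => ∑ y, ‖ξ (e.symm ⟨i, y⟩)‖ ^ p.toReal) (‖ξ‖ ^ p.toReal) := by
  have hr := toReal_pos_of_fact hp
  have h : Summable fun z => ‖ξ z‖ ^ p.toReal := (lp.memℓp ξ).summable hr
  have h1 : ‖ξ‖ ^ p.toReal = ∑' z, ‖ξ z‖ ^ p.toReal := lp.norm_rpow_eq_tsum hr ξ
  rw [h1]
  exact hasSum_blocks e (h := fun z => ‖ξ z‖ ^ p.toReal) h

theorem summable_of_blocks (e : Z ≃ Σ i, κ i) {h : Z → ℝ} (h0 : ∀ z, 0 ≤ h z)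
    (hs : Summable fun i => ∑ y, h (e.symm ⟨i, y⟩)) : Summable h := by
  refine e.symm.summable_iff.1 ((summable_sigma_of_nonneg fun _ => h0 _).2 ?_)
  refine ⟨fun i => Summable.of_finite, ?_⟩
  simpa only [tsum_fintype] using hs

/-- `T` is the operator `(⊕ i, A i) ⊗ P` on `ℓ^p(Z, ℓ^p)`, where `e` decomposes `Z` into the
finite blocks `κ i`. -/
def IsBlockTensor (e : Z ≃ Σ i, κ i) (A : ∀ i, Matrix (κ i) (κ i) ℂ) (P : EllP p →L[ℂ] EllP p)
    (T : EllPOn p Z →L[ℂ] EllPOn p Z) : Prop :=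
  ∀ (ξ : EllPOn p Z) (i : ℕ) (x : κ i),
    T ξ (e.symm ⟨i, x⟩) = P (∑ y, A i x y • ξ (e.symm ⟨i, y⟩))

/-- A block tensor operator is determined by its data. -/
theorem IsBlockTensor.unique {e : Z ≃ Σ i, κ i} {A : ∀ i, Matrix (κ i) (κ i) ℂ}
    {P : EllP p →L[ℂ] EllP p} {S T : EllPOn p Z →L[ℂ] EllPOn p Z} (hS : IsBlockTensor e A P S)
    (hT : IsBlockTensor e A P T) : S = T := by
  ext1 ξ
  exact ext_blocks e fun i x => (hS ξ i x).trans (hT ξ i x).symm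

theorem sum_blocks_norm_le (hp : p ≠ ∞) (e : Z ≃ Σ i, κ i) {A : ∀ i, Matrix (κ i) (κ i) ℂ}
    (P : EllP p →L[ℂ] EllP p) {C : ℝ} (hC : 0 ≤ C) (h : ∀ i, LpBound p.toReal C (A i))
    (ξ : Z → EllP p) (i : ℕ) :
    ∑ x, ‖P (∑ y, A i x y • ξ (e.symm ⟨i, y⟩))‖ ^ p.toReal ≤
      (C * ‖P‖) ^ p.toReal * ∑ y, ‖ξ (e.symm ⟨i, y⟩)‖ ^ p.toReal := by
  have hr := toReal_pos_of_fact hp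
  calc ∑ x, ‖P (∑ y, A i x y • ξ (e.symm ⟨i, y⟩))‖ ^ p.toReal
      ≤ ∑ x, ‖P‖ ^ p.toReal * ‖∑ y, A i x y • ξ (e.symm ⟨i, y⟩)‖ ^ p.toReal := by
        refine Finset.sum_le_sum fun x _ => ?_
        rw [← Real.mul_rpow (norm_nonneg _) (norm_nonneg _)]
        exact Real.rpow_le_rpow (norm_nonneg _) (P.le_opNorm _) hr.le
    _ ≤ ‖P‖ ^ p.toReal * (C ^ p.toReal * ∑ y, ‖ξ (e.symm ⟨i, y⟩)‖ ^ p.toReal) := by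
        rw [← Finset.mul_sum]
        gcongr
        exact (h i).sum_norm_lp_le hp fun y => ξ (e.symm ⟨i, y⟩)
    _ = _ := by rw [Real.mul_rpow hC (norm_nonneg _)]; ring

/-- Blocks with a common bound `C` on `ℓ^p` define an operator of norm at most `C ‖P‖`. -/
theorem exists_isBlockTensor (hp : p ≠ ∞) (e : Z ≃ Σ i, κ i) {A : ∀ i, Matrix (κ i) (κ i) ℂ}
    (P : EllP p →L[ℂ] EllP p) {C : ℝ} (hC : 0 ≤ C) (h : ∀ i, LpBound p.toReal C (A i)) :
    ∃ T : EllPOn p Z →L[ℂ] EllPOn p Z, ‖T‖ ≤ C * ‖P‖ ∧ IsBlockTensor e A P T := by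
  have hr := toReal_pos_of_fact hp
  let F : (Z → EllP p) → Z → EllP p := fun ξ z =>
    P (∑ y, A (e z).1 (e z).2 y • ξ (e.symm ⟨(e z).1, y⟩))
  have hF : ∀ ξ i (x : κ i), F ξ (e.symm ⟨i, x⟩) = P (∑ y, A i x y • ξ (e.symm ⟨i, y⟩)) := by
    intro ξ i x
    simp only [F]
    rw [Equiv.apply_symm_apply]
  have hblock : ∀ ξ i, ∑ x, ‖F ξ (e.symm ⟨i, x⟩)‖ ^ p.toReal ≤
      (C * ‖P‖) ^ p.toReal * ∑ y, ‖ξ (e.symm ⟨i, y⟩)‖ ^ p.toReal := by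
    intro ξ i
    simp only [hF]
    exact sum_blocks_norm_le hp e P hC h ξ i
  have hξ : ∀ ξ : EllPOn p Z, HasSum (fun i => ∑ y, ‖ξ (e.symm ⟨i, y⟩)‖ ^ p.toReal)
      (‖ξ‖ ^ p.toReal) := fun ξ => hasSum_blocks_norm hp e ξ
  have hsum : ∀ ξ : EllPOn p Z, Summable fun z => ‖F ξ z‖ ^ p.toReal := by
    intro ξ
    refine summable_of_blocks e (fun z => by positivity) ?_
    exact Summable.of_nonneg_of_le (fun i => by positivity) (hblock ξ)
      ((hξ ξ).summable.mul_left _)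
  have hnorm : ∀ ξ : EllPOn p Z,
      ‖(⟨F ξ, memℓp_gen (hsum ξ)⟩ : EllPOn p Z)‖ ≤ C * ‖P‖ * ‖ξ‖ := by
    intro ξ
    have h1 : ∑' z, ‖F ξ z‖ ^ p.toReal ≤ (C * ‖P‖ * ‖ξ‖) ^ p.toReal := by
      rw [Real.mul_rpow (by positivity) (norm_nonneg _)]
      exact hasSum_le (hblock ξ) (hasSum_blocks e (h := fun z => ‖F ξ z‖ ^ p.toReal) (hsum ξ))
        ((hξ ξ).mul_left _)
    exact lp.norm_le_of_tsum_le hr (by positivity) h1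
  refine ⟨LinearMap.mkContinuous
    { toFun := fun ξ => (⟨F ξ, memℓp_gen (hsum ξ)⟩ : EllPOn p Z)
      map_add' := fun ξ η => ext_blocks e fun i x => ?_
      map_smul' := fun c ξ => ext_blocks e fun i x => ?_ } (C * ‖P‖) hnorm,
    LinearMap.mkContinuous_norm_le _ (by positivity) _, fun ξ i x => hF ξ i x⟩
  · change F (⇑ξ + ⇑η) _ = F ξ _ + F η _
    simp only [hF, Pi.add_apply, smul_add, Finset.sum_add_distrib, map_add]
  · change F (c • ⇑ξ) _ = c • F ξ _
    simp only [hF, Pi.smul_apply, smul_comm _ c, ← Finset.smul_sum, map_smul]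

section Algebra

variable {e : Z ≃ Σ i, κ i} {A B : ∀ i, Matrix (κ i) (κ i) ℂ} {P R : EllP p →L[ℂ] EllP p}
  {S T : EllPOn p Z →L[ℂ] EllPOn p Z}

theorem IsBlockTensor.sub (hS : IsBlockTensor e A P S) (hT : IsBlockTensor e B P T) :
    IsBlockTensor e (A - B) P (S - T) := by
  intro ξ i x
  change S ξ _ - T ξ _ = _
  rw [hS, hT, ← map_sub, ← Finset.sum_sub_distrib]
  simp only [Pi.sub_apply, Matrix.sub_apply, sub_smul]

theorem IsBlockTensor.mul (hS : IsBlockTensor e A P S) (hT : IsBlockTensor e B R T) :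
    IsBlockTensor e (A * B) (P * R) (S * T) := by
  intro ξ i x
  change S (T ξ) _ = P (R _)
  rw [hS]
  simp only [hT ξ i, ← map_smul, ← map_sum, Pi.mul_apply, Matrix.mul_apply, Finset.sum_smul,
    Finset.smul_sum, smul_smul]
  rw [Finset.sum_comm]

/-- The matrix entries of `(⊕ i, A i) ⊗ P`. -/
theorem IsBlockTensor.entry_eq (hT : IsBlockTensor e A P T) (x y : Z) :
    entry T x y =
      Matrix.blockDiagonal' A (e x) (e y) • P := by
  classical
  obtain ⟨⟨i, a⟩, rfl⟩ := e.symm.surjective x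
  obtain ⟨⟨j, b⟩, rfl⟩ := e.symm.surjective y
  ext1 v
  rw [entry_apply, hT]
  have h1 : ∀ c : κ i, inclAt p (e.symm ⟨j, b⟩) v (e.symm ⟨i, c⟩) =
      if (⟨i, c⟩ : Σ i, κ i) = ⟨j, b⟩ then v else 0 := by
    intro c
    change lp.single (E := fun _ : Z => EllP p) p _ v _ = _
    rw [lp.single_apply, Pi.single_apply]
    simp only [EmbeddingLike.apply_eq_iff_eq]
  simp only [h1, Equiv.apply_symm_apply]
  rw [smul_apply]
  rcases eq_or_ne i j with rfl | hij
  · rw [Matrix.blockDiagonal'_apply_eq]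
    simp
  · rw [Matrix.blockDiagonal'_apply_ne _ _ _ hij]
    simp [hij]

end Algebra

end BlockTensor

/-! ### Compactness -/

/-- A bounded operator of finite rank is compact. -/
theorem isCompactOperator_of_finiteDimensional_range {E F : Type*} [NormedAddCommGroup E]
    [NormedSpace ℂ E] [NormedAddCommGroup F] [NormedSpace ℂ F] (P : E →L[ℂ] F)
    [FiniteDimensional ℂ P.range] : IsCompactOperator P := by
  have : ProperSpace P.range := FiniteDimensional.proper ℂ _
  exact (isCompactOperator_id.comp_clm P.rangeRestrict).clm_comp P.range.subtypeL

/-- The projection of `ℓ^p` onto its first coordinate axis is an idempotent of rank one. -/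
theorem exists_finiteRank_idempotent (p : ℝ≥0∞) [Fact (1 ≤ p)] :
    ∃ P : EllP p →L[ℂ] EllP p, P * P = P ∧ P ≠ 0 ∧ FiniteDimensional ℂ P.range := by
  let f : ℂ →L[ℂ] EllP p := lp.singleContinuousLinearMap ℂ (fun _ : ℕ => ℂ) p 0
  let g : EllP p →L[ℂ] ℂ := lp.evalCLM ℂ (fun _ : ℕ => ℂ) p 0
  have hgf : ∀ z, g (f z) = z := fun z => lp.single_apply_self (E := fun _ : ℕ => ℂ) p 0 z
  refine ⟨f.comp g, ?_, fun h => ?_, ?_⟩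
  · ext1 v
    change f (g (f (g v))) = f (g v)
    rw [hgf]
  · have h1 : f (g (f 1)) = 0 := congrArg (fun T : EllP p →L[ℂ] EllP p => T (f 1)) h
    rw [hgf] at h1
    have h2 := hgf 1
    rw [h1, map_zero] at h2
    exact zero_ne_one h2
  · have h : (f.comp g).range ≤ f.range := LinearMap.range_comp_le_range _ _
    exact Submodule.finiteDimensional_of_le h

section Blocks

variable {p : ℝ≥0∞} [Fact (1 ≤ p)] {Z : Type*} {κ : ℕ → Type*} [∀ i, Fintype (κ i)]
  {e : Z ≃ Σ i, κ i} {A : ∀ i, Matrix (κ i) (κ i) ℂ} {P : EllP p →L[ℂ] EllP p}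
  {Q : EllPOn p Z →L[ℂ] EllPOn p Z}

theorem sum_inclAt_block_apply (e : Z ≃ Σ i, κ i) (i j : ℕ) (x : κ j) (v : EllP p) :
    (∑ y : κ i, inclAt p (e.symm ⟨i, y⟩) v) (e.symm ⟨j, x⟩) = if i = j then v else 0 := by
  classical
  rw [lp.coeFn_sum, Finset.sum_apply]
  have h1 : ∀ y : κ i, inclAt p (e.symm ⟨i, y⟩) v (e.symm ⟨j, x⟩) =
      if (⟨j, x⟩ : Σ i, κ i) = ⟨i, y⟩ then v else 0 := by
    intro y
    change lp.single (E := fun _ : Z => EllP p) p _ v _ = _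
    rw [lp.single_apply, Pi.single_apply]
    simp only [EmbeddingLike.apply_eq_iff_eq]
  simp only [h1]
  rcases eq_or_ne i j with rfl | hij
  · simp
  · simp [hij, hij.symm]

/-- An operator `(⊕ i, A i) ⊗ P` with `P v = v ≠ 0` whose blocks all fix the constants is not
compact: it fixes the normalized indicators of the blocks, with values in the line of `v`, and these
converge pointwise to zero. -/
theorem IsBlockTensor.not_isCompactOperator [∀ i, Nonempty (κ i)] (hQ : IsBlockTensor e A P Q)
    (hA : ∀ i x, ∑ y, A i x y = 1) {v : EllP p} (hv : v ≠ 0) (hP : P v = v) :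
    ¬ IsCompactOperator Q := by
  intro hcomp
  let w : ℕ → EllPOn p Z := fun i => ∑ y : κ i, inclAt p (e.symm ⟨i, y⟩) v
  have hw : ∀ i j (x : κ j), w i (e.symm ⟨j, x⟩) = if i = j then v else 0 :=
    fun i j x => sum_inclAt_block_apply e i j x v
  have hw0 : ∀ i, w i ≠ 0 := by
    intro i h0
    obtain ⟨x⟩ := (inferInstance : Nonempty (κ i))
    have h1 := hw i i x
    rw [h0, if_pos rfl] at h1
    exact hv h1.symm
  have hQw : ∀ i, Q (w i) = w i := by
    intro i
    refine ext_blocks e fun j x => ?_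
    rw [hQ]
    simp only [hw]
    split_ifs with h
    · rw [← Finset.sum_smul, hA, one_smul, hP]
    · simp
  let u : ℕ → EllPOn p Z := fun i => ((‖w i‖⁻¹ : ℝ) : ℂ) • w i
  have hu1 : ∀ i, ‖u i‖ = 1 := by
    intro i
    simp only [u]
    rw [norm_smul, Complex.norm_real, norm_inv, norm_norm,
      inv_mul_cancel₀ (norm_ne_zero_iff.2 (hw0 i))]
  have hQu : ∀ i, Q (u i) = u i := by
    intro i
    simp only [u]
    rw [map_smul, hQw]
  obtain ⟨K, hK, hKQ⟩ := IsCompactOperator.image_closedBall_subset_compact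
    (f := (Q : EllPOn p Z →ₗ[ℂ] EllPOn p Z)) hcomp 1
  have huK : ∀ i, u i ∈ K := fun i => hKQ ⟨u i, by simp [hu1], hQu i⟩
  obtain ⟨L, -, φ, hφ, hL⟩ := hK.tendsto_subseq huK
  have hL1 : ‖L‖ = 1 := by
    refine tendsto_nhds_unique hL.norm ?_
    simp only [Function.comp_apply, hu1]
    exact tendsto_const_nhds
  -- Pointwise, the sequence is eventually zero.
  have hL0 : L = 0 := by
    refine ext_blocks e fun j x => ?_
    have h1 : Tendsto (fun n => evalAt p (e.symm ⟨j, x⟩) (u (φ n))) atTop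
        (𝓝 (evalAt p (e.symm ⟨j, x⟩) L)) :=
      ((evalAt p (e.symm ⟨j, x⟩)).continuous.tendsto L).comp hL
    refine tendsto_nhds_unique h1 (tendsto_const_nhds.congr' ?_)
    filter_upwards [eventually_gt_atTop j] with n hn
    have hne : φ n ≠ j := (hn.trans_le (hφ.id_le n)).ne'
    change _ = ((‖w (φ n)‖⁻¹ : ℝ) : ℂ) • w (φ n) (e.symm ⟨j, x⟩)
    rw [hw, if_neg hne, smul_zero]
    rfl
  rw [hL0, norm_zero] at hL1
  exact zero_ne_one hL1

/-- Averaging over a block of `n` points a function supported on `F` spreads its mass: the norm is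
at most `n ^ (1 / p - 1)` times `|F|`, up to `‖P‖`. -/
theorem IsBlockTensor.norm_apply_le_of_support (hp : p ≠ ∞) (hQ : IsBlockTensor e A P Q)
    {i : ℕ} (hA : ∀ x y, A i x y = 1 / (Fintype.card (κ i) : ℂ)) {F : Set (κ i)} (hF : F.Finite)
    {ξ : EllPOn p Z} (hξ : ‖ξ‖ = 1)
    (hs : ∀ z, ξ z ≠ 0 → ∃ y ∈ F, z = e.symm ⟨i, y⟩) :
    ‖Q ξ‖ ≤ ‖P‖ * F.ncard * (Fintype.card (κ i) : ℝ) ^ (-(1 - 1 / p.toReal)) := by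
  classical
  have hr := toReal_pos_of_fact hp
  have hp0 : p ≠ 0 := (zero_lt_one.trans_le (Fact.out : 1 ≤ p)).ne'
  set n : ℝ := ((Fintype.card (κ i) : ℕ) : ℝ)
  have hn0 : 0 ≤ n := Nat.cast_nonneg _
  set C : ℝ := ‖P‖ * F.ncard
  have hC0 : 0 ≤ C := by positivity
  -- On the block, `Q ξ` is constant, and the sum of the values of `ξ` has at most `|F|` terms.
  have hpt : ∀ x, ‖Q ξ (e.symm ⟨i, x⟩)‖ ≤ C * n⁻¹ := by
    intro x
    rw [hQ]
    have hsum : ‖∑ y, ξ (e.symm ⟨i, y⟩)‖ ≤ F.ncard := by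
      rw [← Finset.sum_subset (Finset.subset_univ hF.toFinset)]
      · refine (norm_sum_le _ _).trans ?_
        rw [Set.ncard_eq_toFinset_card F hF]
        refine (Finset.sum_le_card_nsmul _ _ 1 fun y _ => ?_).trans_eq (by simp)
        exact (lp.norm_apply_le_norm hp0 ξ _).trans_eq hξ
      · intro y _ hy
        by_contra hne
        obtain ⟨y', hy', h⟩ := hs _ hne
        have h2 := e.symm.injective h
        simp only [Sigma.mk.injEq, heq_eq_eq, true_and] at h2
        exact hy (hF.mem_toFinset.2 (h2 ▸ hy'))
    refine (P.le_opNorm _).trans ?_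
    simp only [hA]
    rw [← Finset.smul_sum, norm_smul, norm_div, norm_one, Complex.norm_natCast, one_div]
    calc ‖P‖ * (n⁻¹ * ‖∑ y, ξ (e.symm ⟨i, y⟩)‖) ≤ ‖P‖ * (n⁻¹ * F.ncard) := by gcongr
      _ = C * n⁻¹ := by ring
  -- `Q` preserves the blocks, so only the block of `ξ` contributes to the norm.
  have hoff : ∀ j, j ≠ i → ∑ x, ‖Q ξ (e.symm ⟨j, x⟩)‖ ^ p.toReal = 0 := by
    intro j hj
    refine Finset.sum_eq_zero fun x _ => ?_
    have h0 : ∀ y : κ j, ξ (e.symm ⟨j, y⟩) = 0 := by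
      intro y
      by_contra hne
      obtain ⟨y', -, h⟩ := hs _ hne
      exact hj (congrArg Sigma.fst (e.symm.injective h))
    rw [hQ]
    simp [h0, Real.zero_rpow hr.ne']
  have hnorm : ‖Q ξ‖ ^ p.toReal = ∑ x, ‖Q ξ (e.symm ⟨i, x⟩)‖ ^ p.toReal :=
    (hasSum_blocks_norm hp e (Q ξ)).unique (hasSum_single i hoff)
  have hle : ‖Q ξ‖ ^ p.toReal ≤ n * (C * n⁻¹) ^ p.toReal := by
    rw [hnorm]
    refine (Finset.sum_le_card_nsmul _ _ ((C * n⁻¹) ^ p.toReal) fun x _ => ?_).trans_eq ?_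
    · exact Real.rpow_le_rpow (norm_nonneg _) (hpt x) hr.le
    · rw [nsmul_eq_mul, Finset.card_univ]
  rcases hn0.eq_or_lt with hn | hn
  · rw [← hn, zero_mul] at hle
    have h1 : ‖Q ξ‖ ^ p.toReal = 0 := le_antisymm hle (by positivity)
    rw [(Real.rpow_eq_zero (norm_nonneg _) hr.ne').1 h1]
    positivity
  rw [← Real.rpow_le_rpow_iff (norm_nonneg _) (by positivity) hr]
  refine hle.trans_eq ?_
  rw [Real.mul_rpow hC0 (by positivity), Real.mul_rpow hC0 (by positivity), ← Real.rpow_mul hn0,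
    Real.inv_rpow hn0, ← Real.rpow_neg hn0, mul_left_comm]
  congr 1
  nth_rewrite 1 [← Real.rpow_one n]
  rw [← Real.rpow_add hn]
  congr 1
  field_simp
  ring

end Blocks

/-! ### Geometry of the box space -/

section Geometry

variable {G : Type*} [Group G] {S : Finset G}

/-- The infimum defining the word length is over a nonempty set, as `S` generates `G`; so it is
attained, and is not the default value `0`. -/
theorem exists_list_length_eq_wordLength (hS : Subgroup.closure (S : Set G) = ⊤) (g : G) :
    ∃ l : List G, l.length = wordLength S g ∧ (∀ s ∈ l, s ∈ S ∨ s⁻¹ ∈ S) ∧ l.prod = g := by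
  have hg : g ∈ Subgroup.closure (S : Set G) := hS ▸ Subgroup.mem_top g
  rw [← Subgroup.mem_toSubmonoid, Subgroup.closure_toSubmonoid] at hg
  obtain ⟨l, hl, hl'⟩ := Submonoid.exists_list_of_mem_closure hg
  exact Nat.sInf_mem (s := {n | ∃ l : List G, l.length = n ∧
    (∀ s ∈ l, s ∈ S ∨ s⁻¹ ∈ S) ∧ l.prod = g}) ⟨l.length, l, rfl, hl, hl'⟩

theorem finite_wordLength_le (hS : Subgroup.closure (S : Set G) = ⊤) (k : ℕ) :
    {g : G | wordLength S g ≤ k}.Finite := by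
  let W : Set G := {s | s ∈ S ∨ s⁻¹ ∈ S}
  have hW : W.Finite := by
    refine (S.finite_toSet.union S.finite_toSet.inv).subset ?_
    rintro s (h | h)
    · exact Or.inl h
    · exact Or.inr h
  have : Finite W := hW.to_subtype
  refine ((List.finite_length_le W k).image fun l => (l.map Subtype.val).prod).subset ?_
  intro g hg
  obtain ⟨l, h1, h2, h3⟩ := exists_list_length_eq_wordLength hS g
  lift l to List W using h2
  exact ⟨l, by simpa [← h1] using hg, h3⟩

/-- The minimum defining the quotient distance is attained: the distance from `x` to `y` is the length
of some `g` with `x g = y`. -/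
theorem exists_mul_eq_of_quotientWordDist (N : Subgroup G) [N.Normal] (x y : G ⧸ N) :
    ∃ g : G, wordLength S g = quotientWordDist S N x y ∧ x * (g : G ⧸ N) = y := by
  obtain ⟨a₀, ha₀⟩ := QuotientGroup.mk_surjective x
  obtain ⟨b₀, hb₀⟩ := QuotientGroup.mk_surjective y
  obtain ⟨a, b, rfl, rfl, h⟩ := Nat.sInf_mem (s := {n | ∃ a b : G, (a : G ⧸ N) = x ∧
    (b : G ⧸ N) = y ∧ wordLength S (a⁻¹ * b) = n}) ⟨_, a₀, b₀, ha₀, hb₀, rfl⟩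
  refine ⟨a⁻¹ * b, h, ?_⟩
  rw [← QuotientGroup.mk_mul, mul_inv_cancel_left]

theorem quotientWordDist_mul_le (N : Subgroup G) [N.Normal] (x : G ⧸ N) (g : G) :
    quotientWordDist S N x (x * (g : G ⧸ N)) ≤ wordLength S g := by
  obtain ⟨a, rfl⟩ := QuotientGroup.mk_surjective x
  exact Nat.sInf_le ⟨a, a * g, rfl, rfl, by rw [inv_mul_cancel_left]⟩

variable {N : ℕ → Subgroup G}

theorem finite_block_lt [∀ i, Finite (G ⧸ N i)] (n : ℕ) :
    {x : BoxSpace N | x.1 < n}.Finite := by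
  refine ((Finset.range n).finite_toSet.biUnion fun i _ =>
    Set.finite_range (BoxSpace.pt i : G ⧸ N i → BoxSpace N)).subset ?_
  rintro ⟨i, x⟩ hi
  exact Set.mem_biUnion (x := i) (Finset.mem_coe.2 (Finset.mem_range.2 hi)) ⟨x, rfl⟩

variable [MetricSpace (BoxSpace N)]

theorem IsBoxMetric.one_le_dist (hd : IsBoxMetric S N) {x y : BoxSpace N} (h : x ≠ y) :
    1 ≤ dist x y := by
  obtain ⟨i, x⟩ := x
  obtain ⟨j, y⟩ := y
  rcases eq_or_ne i j with rfl | hij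
  · have h1 := hd.1 i x y
    have h2 : 0 < dist (BoxSpace.pt i x : BoxSpace N) (BoxSpace.pt i y) := dist_pos.2 h
    change 1 ≤ dist (BoxSpace.pt i x : BoxSpace N) (BoxSpace.pt i y)
    rw [h1] at h2 ⊢
    exact_mod_cast h2
  · refine le_trans ?_ (hd.2 i j hij x y)
    have : 1 ≤ i + j := by omega
    exact_mod_cast this

theorem IsBoxMetric.eq_univ_of_dense (hd : IsBoxMetric S N) {Z : Set (BoxSpace N)}
    (hZ : Dense Z) : Z = Set.univ := by
  refine Set.eq_univ_of_forall fun x => ?_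
  obtain ⟨z, hz, hzZ⟩ := Metric.dense_iff.1 hZ x 1 one_pos
  by_contra hx
  have hne : z ≠ x := fun h => hx (h ▸ hzZ)
  exact absurd (hd.one_le_dist hne) (not_le.2 hz)

theorem IsBoxMetric.finite_of_isBounded [∀ i, Finite (G ⧸ N i)] (hd : IsBoxMetric S N)
    {B : Set (BoxSpace N)} (hB : Bornology.IsBounded B) : B.Finite := by
  obtain ⟨r, hr⟩ := (Metric.isBounded_iff_subset_closedBall
    (BoxSpace.pt 0 ((1 : G) : G ⧸ N 0) : BoxSpace N)).1 hB
  refine (finite_block_lt (⌈r⌉₊ + 1)).subset ?_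
  rintro ⟨i, x⟩ hx
  rcases Nat.eq_zero_or_pos i with rfl | hi
  · exact Nat.succ_pos _
  have h1 : dist (BoxSpace.pt i x : BoxSpace N) (BoxSpace.pt 0 ((1 : G) : G ⧸ N 0)) ≤ r := hr hx
  have h2 := hd.2 i 0 hi.ne' x ((1 : G) : G ⧸ N 0)
  have h3 : (i : ℝ) ≤ ⌈r⌉₊ := by
    have := Nat.le_ceil r
    push_cast at h2
    linarith
  have h4 : i ≤ ⌈r⌉₊ := by exact_mod_cast h3
  exact Nat.lt_succ_of_le h4

/-- A ball of radius `R` about a point of a block of index at least `R` stays in this block, where it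
consists of translates by group elements of length at most `R`. -/
theorem IsBoxMetric.exists_mul_eq_of_mem_ball [∀ i, (N i).Normal] (hd : IsBoxMetric S N) {R : ℝ}
    {i : ℕ} (hR : R ≤ i) (x : G ⧸ N i) {z : BoxSpace N}
    (hz : z ∈ Metric.ball (BoxSpace.pt i x : BoxSpace N) R) :
    ∃ g : G, wordLength S g ≤ ⌈R⌉₊ ∧ z = BoxSpace.pt i (x * (g : G ⧸ N i)) := by
  obtain ⟨j, y⟩ := z
  have hz' : dist (BoxSpace.pt i x : BoxSpace N) (BoxSpace.pt j y) < R := by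
    rw [dist_comm]; exact hz
  rcases eq_or_ne i j with rfl | hij
  · obtain ⟨g, hg, hgy⟩ := exists_mul_eq_of_quotientWordDist (S := S) (N i) x y
    refine ⟨g, ?_, by rw [hgy]; rfl⟩
    rw [hd.1, ← hg] at hz'
    exact_mod_cast hz'.le.trans (Nat.le_ceil R)
  · have h1 := hd.2 i j hij x y
    have : (0 : ℝ) ≤ j := Nat.cast_nonneg j
    linarith

/-- In an infinite group, the indices of a decreasing sequence of finite index subgroups with
trivial intersection tend to infinity: any finite set of group elements is eventually separated. -/
theorem tendsto_index_atTop {G : Type*} [Group G] [Infinite G] {N : ℕ → Subgroup G}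
    [∀ i, (N i).FiniteIndex] (hN : Antitone N) (hN' : ⨅ i, N i = ⊥) :
    Tendsto (fun i => (N i).index) atTop atTop := by
  refine tendsto_atTop.2 fun M => ?_
  obtain ⟨F, hF⟩ := Infinite.exists_subset_card_eq G M
  have hsep : ∀ g : G, g ≠ 1 → ∀ᶠ i in atTop, g ∉ N i := by
    intro g hg
    have h1 : g ∉ ⨅ i, N i := by rwa [hN', Subgroup.mem_bot]
    rw [Subgroup.mem_iInf, not_forall] at h1
    obtain ⟨i, hi⟩ := h1
    filter_upwards [eventually_ge_atTop i] with j hj h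
    exact hi (hN hj h)
  have hall : ∀ᶠ i in atTop, ∀ a ∈ F, ∀ b ∈ F, a ≠ b → a⁻¹ * b ∉ N i := by
    refine (eventually_all_finset F).2 fun a _ => (eventually_all_finset F).2 fun b _ => ?_
    by_cases hab : a = b
    · exact Eventually.of_forall fun i h => absurd hab h
    · filter_upwards [hsep (a⁻¹ * b) fun h => hab (inv_mul_eq_one.1 h)] with i hi _
      exact hi
  filter_upwards [hall] with i hi
  let _ : Fintype (G ⧸ N i) := Fintype.ofFinite _
  rw [← card_quotient_eq_index, ← hF, ← Finset.card_univ]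
  refine Finset.card_le_card_of_injOn (fun g => (g : G ⧸ N i)) (fun _ _ => Finset.mem_univ _) ?_
  intro a ha b hb hab
  by_contra hne
  exact hi a ha b hb hne (QuotientGroup.eq.1 hab)

end Geometry

/-! ### The ghost projection -/

section Box

variable {G : Type*} [Group G] {N : ℕ → Subgroup G} {Z : Set (BoxSpace N)} {p : ℝ≥0∞}
  [Fact (1 ≤ p)]

/-- The decomposition into blocks of the whole box space, viewed as a subset of itself. -/
def boxEquiv (hZ : Z = Set.univ) : Z ≃ Σ i, G ⧸ N i :=
  (Equiv.setCongr hZ).trans (Equiv.Set.univ (BoxSpace N))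

variable {P : EllP p →L[ℂ] EllP p} {T Q : EllPOn p Z →L[ℂ] EllPOn p Z}

theorem IsBlockTensor.isTensor [∀ i, Fintype (G ⧸ N i)] {hZ : Z = Set.univ}
    {A : ∀ i, Matrix (G ⧸ N i) (G ⧸ N i) ℂ} (hT : IsBlockTensor (boxEquiv hZ) A P T) :
    IsTensor (boxMatrix A) P T :=
  fun x y => hT.entry_eq x y

variable [MetricSpace (BoxSpace N)] {S : Finset G}

/-- The operators `(⊕ i, ρ_i(f)) ⊗ P` with `P` compact lie in the algebraic Roe algebra: their
propagation is at most the largest word length of an element of the support of `f`. -/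
theorem IsTensor.mem_algebraicRoeAlgebra [∀ i, (N i).Normal] [∀ i, Finite (G ⧸ N i)]
    (hd : IsBoxMetric S N) {f : MonoidAlgebra ℝ G}
    (hT : IsTensor (boxMatrix fun i => regularMatrix (N i) f) P T) (hP : IsCompactOperator P) :
    T ∈ algebraicRoeAlgebra p Z := by
  classical
  refine ⟨⟨f.coeff.support.sup (wordLength S) + 1, by positivity, fun x y hxy => ?_⟩,
    fun x y => ?_, fun B hB => ?_⟩
  · rw [hT x y]
    suffices h : boxMatrix (fun i => regularMatrix (N i) f) (x : BoxSpace N) y = 0 by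
      rw [h, zero_smul]
    obtain ⟨⟨i, a⟩, hx⟩ := x
    obtain ⟨⟨j, b⟩, hy⟩ := y
    rcases eq_or_ne i j with rfl | hij
    · refine (Matrix.blockDiagonal'_apply_eq (m' := fun i => G ⧸ N i)
        (n' := fun i => G ⧸ N i) (fun i => regularMatrix (N i) f) i a b).trans ?_
      refine Finset.sum_eq_zero fun g hg => if_neg fun hgb => ?_
      have h1 : dist (BoxSpace.pt i a : BoxSpace N) (BoxSpace.pt i b) ≤ wordLength S g := by
        rw [hd.1, ← hgb]
        exact_mod_cast quotientWordDist_mul_le (N i) a g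
      have h2 : (wordLength S g : ℝ) ≤ f.coeff.support.sup (wordLength S) := by
        exact_mod_cast Finset.le_sup (f := wordLength S) hg
      have h3 : ((f.coeff.support.sup (wordLength S) : ℕ) : ℝ) + 1 <
        dist (BoxSpace.pt i a : BoxSpace N) (BoxSpace.pt i b) := hxy
      linarith
    · exact Matrix.blockDiagonal'_apply_ne (m' := fun i => G ⧸ N i) (n' := fun i => G ⧸ N i)
        (fun i => regularMatrix (N i) f) a b hij
  · rw [hT x y]
    exact hP.smul (boxMatrix (fun i => regularMatrix (N i) f) (x : BoxSpace N) y)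
  · have hfin : ((fun z : Z => (z : BoxSpace N)) ⁻¹' B).Finite :=
      (hd.finite_of_isBounded hB).preimage Subtype.val_injective.injOn
    exact (hfin.prod hfin).subset fun q hq => ⟨hq.1, hq.2.1⟩

/-- The operator `(⊕ i, q_i) ⊗ P` is a ghost: balls of a fixed radius have boundedly many points,
while the blocks grow, so a unit vector supported in a ball far out is averaged to a small one. -/
theorem IsBlockTensor.isGhost [Infinite G] [∀ i, (N i).Normal] [∀ i, (N i).FiniteIndex]
    [∀ i, Fintype (G ⧸ N i)] (hp1 : 1 < p) (hp : p ≠ ∞)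
    (hS : Subgroup.closure (S : Set G) = ⊤) (hN : Antitone N) (hN' : ⨅ i, N i = ⊥)
    (hd : IsBoxMetric S N) {hZ : Z = Set.univ}
    (hQ : IsBlockTensor (boxEquiv hZ) (fun i => averagingMatrix (N i)) P Q) : IsGhost Q := by
  intro R ε _ hε
  have hfin := finite_wordLength_le hS ⌈R⌉₊
  set K : ℕ := {g : G | wordLength S g ≤ ⌈R⌉₊}.ncard
  have hexp : 0 < 1 - 1 / p.toReal := by
    have h1 : 1 < p.toReal := by
      rwa [← ENNReal.toReal_one, ENNReal.toReal_lt_toReal ENNReal.one_ne_top hp]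
    rw [sub_pos, div_lt_one (zero_lt_one.trans h1)]
    exact h1
  have hlim : Tendsto (fun i => ‖P‖ * K * ((N i).index : ℝ) ^ (-(1 - 1 / p.toReal))) atTop
      (𝓝 0) := by
    have h1 := (tendsto_rpow_neg_atTop hexp).comp
      (tendsto_natCast_atTop_atTop.comp (tendsto_index_atTop hN hN'))
    simpa using h1.const_mul (‖P‖ * K)
  obtain ⟨m, hm⟩ := eventually_atTop.1 (hlim.eventually (gt_mem_nhds hε))
  -- Beyond the block `⌈R⌉₊`, balls of radius `R` do not leave their block.
  refine ⟨{x | x.1 < max m ⌈R⌉₊}, (finite_block_lt _).isBounded, ?_⟩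
  rintro ⟨i, x⟩ hx ξ hξ hsupp
  have hx' : max m ⌈R⌉₊ ≤ i := not_lt.1 hx
  have hRi : R ≤ i := (Nat.le_ceil R).trans (by exact_mod_cast (le_max_right _ _).trans hx')
  set F : Set (G ⧸ N i) := (fun g : G => x * (g : G ⧸ N i)) '' {g : G | wordLength S g ≤ ⌈R⌉₊}
  have hFK : F.ncard ≤ K := Set.ncard_image_le hfin
  have h := hQ.norm_apply_le_of_support (i := i) hp
    (fun a b => by rw [card_quotient_eq_index]; rfl) (hfin.image _ : F.Finite) hξ
    (fun z hz => by
      obtain ⟨g, hg, hzg⟩ := hd.exists_mul_eq_of_mem_ball hRi x (hsupp z hz)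
      refine ⟨x * (g : G ⧸ N i), ⟨g, hg, rfl⟩, ?_⟩
      rw [Equiv.eq_symm_apply]
      exact hzg)
  rw [card_quotient_eq_index] at h
  refine (h.trans ?_).trans_lt (hm i ((le_max_left _ _).trans hx'))
  gcongr

theorem averagingMatrix_mul_self {G : Type*} [Group G] (N : Subgroup G) [Fintype (G ⧸ N)] :
    averagingMatrix N * averagingMatrix N = averagingMatrix N := by
  have h := index_cast_ne_zero N
  ext x y
  simp [Matrix.mul_apply, averagingMatrix, card_quotient_eq_index, h]

end Box

theorem mainTheorem2 {G : Type*} [Group G] [Infinite G] (hT : HasPropertyT G)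
    (p : ℝ≥0∞) [Fact (1 ≤ p)] (hp1 : 1 < p) (hp : p < ∞)
    (S : Finset G) (hS : Subgroup.closure (S : Set G) = ⊤)
    (N : ℕ → Subgroup G) [∀ i, (N i).Normal] [∀ i, (N i).FiniteIndex]
    (hN : Antitone N) (hN' : ⨅ i, N i = ⊥)
    [MetricSpace (BoxSpace N)] (hd : IsBoxMetric S N)
    (Z : Set (BoxSpace N)) (hZ : Z.Countable) (hZ' : Dense Z) :
    (∃ Q ∈ roeAlgebra p Z, Q * Q = Q ∧ IsGhost Q ∧ ¬ IsCompactOperator Q) ∧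
    ∃ μ : MonoidAlgebra ℝ G,
      (∀ g, 0 ≤ μ.coeff g) ∧ (∑ g ∈ μ.coeff.support, μ.coeff g = 1) ∧
      (∀ ε : ℝ, 0 < ε → ∃ n₀ : ℕ, ∀ n ≥ n₀, ∀ i,
        lpOpNorm p (regularMatrix (N i) (μ ^ n) - averagingMatrix (N i)) < ε) ∧
      ∀ P : EllP p →L[ℂ] EllP p, P * P = P → P ≠ 0 → FiniteDimensional ℂ P.range →
        ∃ Q ∈ roeAlgebra p Z,
          IsTensor (boxMatrix fun i => averagingMatrix (N i)) P Q ∧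
          Q * Q = Q ∧ IsGhost Q ∧ ¬ IsCompactOperator Q ∧
          ∃ T : ℕ → (EllPOn p Z →L[ℂ] EllPOn p Z),
            (∀ n, T n ∈ algebraicRoeAlgebra p Z ∧
              IsTensor (boxMatrix fun i => regularMatrix (N i) (μ ^ n)) P (T n)) ∧
            Tendsto T atTop (𝓝 Q) := by
  obtain ⟨μ, hμ0, hμ1, hrow, hlim⟩ := hT.exists_measure
  have hr : 1 < p.toReal := by
    rwa [← ENNReal.toReal_one, ENNReal.toReal_lt_toReal ENNReal.one_ne_top hp.ne]
  have hZu : Z = Set.univ := hd.eq_univ_of_dense hZ'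
  have main : ∀ P : EllP p →L[ℂ] EllP p, P * P = P → P ≠ 0 → FiniteDimensional ℂ P.range →
      ∃ Q ∈ roeAlgebra p Z,
        IsTensor (boxMatrix fun i => averagingMatrix (N i)) P Q ∧
        Q * Q = Q ∧ IsGhost Q ∧ ¬ IsCompactOperator Q ∧
        ∃ T : ℕ → (EllPOn p Z →L[ℂ] EllPOn p Z),
          (∀ n, T n ∈ algebraicRoeAlgebra p Z ∧
            IsTensor (boxMatrix fun i => regularMatrix (N i) (μ ^ n)) P (T n)) ∧
          Tendsto T atTop (𝓝 Q) := by
    intro P hPP hP0 hPfin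
    let _ : ∀ i, Fintype (G ⧸ N i) := fun i => Fintype.ofFinite _
    obtain ⟨Q, -, hQ⟩ := exists_isBlockTensor hp.ne (boxEquiv hZu) P zero_le_one
      fun i => lpBound_of_rowColBound hr one_pos (rowColBound_averagingMatrix (N i))
    choose T _ hTn using fun n : ℕ => exists_isBlockTensor hp.ne (boxEquiv hZu) P zero_le_one
      fun i => lpBound_of_rowColBound hr one_pos (hrow (N i) n)
    have hTmem : ∀ n, T n ∈ algebraicRoeAlgebra p Z := fun n =>
      (hTn n).isTensor.mem_algebraicRoeAlgebra hd (isCompactOperator_of_finiteDimensional_range P)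
    have htend : Tendsto T atTop (𝓝 Q) := by
      refine Metric.tendsto_atTop.2 fun ε hε => ?_
      have hPn : 0 < ‖P‖ := norm_pos_iff.2 hP0
      obtain ⟨n₀, hn₀⟩ := hlim p.toReal hr (ε / 2 / ‖P‖) (by positivity)
      refine ⟨n₀, fun n hn => ?_⟩
      obtain ⟨D, hD, hD'⟩ := exists_isBlockTensor hp.ne (boxEquiv hZu) P (by positivity)
        fun i => hn₀ n hn (N i)
      rw [dist_eq_norm, ((hTn n).sub hQ).unique hD']
      rw [div_mul_cancel₀ _ hPn.ne'] at hD
      linarith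
    obtain ⟨v, hv⟩ : ∃ v, P v ≠ 0 := by
      by_contra! h
      exact hP0 (ContinuousLinearMap.ext h)
    have hPv : P (P v) = P v := congrArg (fun R : EllP p →L[ℂ] EllP p => R v) hPP
    refine ⟨Q, ?_, hQ.isTensor, ?_, hQ.isGhost hp1 hp.ne hS hN hN' hd,
      hQ.not_isCompactOperator (fun i x => ?_) hv hPv, T, fun n => ⟨hTmem n, (hTn n).isTensor⟩,
      htend⟩
    · exact mem_closure_of_tendsto htend (Eventually.of_forall hTmem)
    · have hQQ := hQ.mul hQ
      have h1 : ((fun i => averagingMatrix (N i)) * fun i => averagingMatrix (N i)) =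
          fun i => averagingMatrix (N i) := funext fun i => averagingMatrix_mul_self (N i)
      rw [h1, hPP] at hQQ
      exact hQQ.unique hQ
    · have h := index_cast_ne_zero (N i)
      simp [averagingMatrix, card_quotient_eq_index, h]
  refine ⟨?_, μ, hμ0, hμ1, fun ε hε => ?_, main⟩
  · obtain ⟨P, h1, h2, h3⟩ := exists_finiteRank_idempotent p
    obtain ⟨Q, hQ, -, h4, h5, h6, -⟩ := main P h1 h2 h3
    exact ⟨Q, hQ, h4, h5, h6⟩
  · obtain ⟨n₀, hn₀⟩ := hlim p.toReal hr (ε / 2) (half_pos hε)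
    refine ⟨n₀, fun n hn i => ?_⟩
    refine (LpBound.lpOpNorm_le hp.ne (half_pos hε).le ?_).trans_lt (half_lt_self hε)
    let _ : Fintype (G ⧸ N i) := Fintype.ofFinite _
    exact hn₀ n hn (N i)
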